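/- Let $D\ge 3$ and $n\ge 2D$, let $\Gamma=J(n,D)$ be the Johnson graph (vertices: the $D$-subsets of an $n$-set $\Omega$; two of them adjacent when they meet in $D-1$ elements), and fix a vertex $x$, with path-length distance $\partial$. For a finite connected graph with vertex set $X$ and adjacency matrix $A$, let $\varepsilon$ be the eccentricity of $x$, let $E_i^*$ be the diagonal matrix with $(E_i^*)_{yy}=1$ if $\partial(x,y)=i$ and $0$ otherwise, and let the Terwilliger algebra (with respect to $x$) be the algebra of complex matrices generated by $A$ and the $E_i^*$. Put $L=\sum_{i=1}^{\varepsilon}E^*_{i-1}AE^*_i$ and $R=\sum_{i=0}^{\varepsilon-1}E^*_{i+1}AE^*_i$. For an algebra $S$ of complex $X\times X$ matrices, an $S$-module is an $S$-invariant subspace of $V=\mathbb{C}^X$; two $S$-modules are isomorphic if some linear bijection between them commutes with the action of $S$. Let $\Gamma_f$ be the bipartite graph obtained from $\Gamma$ by deleting every edge $yz$ with $\partial(x,y)=\partial(x,z)$, and let $T$ and $T_f$ be the Terwilliger algebras of $\Gamma$ and $\Gamma_f$ with respect to $x$. The graph $\Gamma$ *supports a uniform structure* with respect to $x$ if there are a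 tridiagonal complex matrix $U=(e_{ij})_{1\le i,j\le\varepsilon}$ and a vector $f\in\mathbb{C}^{\varepsilon}$ such that $e_{ii}=1$ for all $i$; either $e_{i,i-1}\ne0$ for all $2\le i\le\varepsilon$ or $e_{i-1,i}\neq 0$ for all $2\le i\le\varepsilon$; every principal submatrix $(e_{ij})_{s\le i,j\le t}$ with $1\le s\le t\le\varepsilon$ is nonsingular; and $$e_i^-RL^2+LRL+e_i^+L^2R=f_iL\quad\text{on }E_i^*V\qquad(1\le i\le\varepsilon),$$ where $L,R,E_i^*,\varepsilon$ are those of $\Gamma_f$, $e_i^-=e_{i,i-1}$ $(i\ge2)$, $e_i^+=e_{i,i+1}$ $(i\le\varepsilon-1)$, $e_1^-=e_\varepsilon^+=0$. The *endpoint* of an irreducible $T$-module $W$ is $\min\{i: E_i^*W\ne0\}$, its *diameter* is $|\{i:E_i^*W\neq0\}|-1$, and its *dual endpoint* is $\min\{i:E_iW\ne0\}$, where $E_i$ is the orthogonal projection of $V$ onto the eigenspace of the adjacency matrix of $\Gamma$ for its $i$-th largest eigenvalue $\theta_i$ ($\theta_0>\theta_1>\cdots$). **Theorem.** (i) $\Gamma=J(n,D)$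 does not support a uniform structure with respect to $x$. (ii) If $n>2D$, then every irreducible $T$-module with endpoint $1$ and diameter $D-2$ has dual endpoint $1$ or $2$; for each of these two values there is, up to isomorphism of $T$-modules, exactly one such module. These two modules are also $T_f$-modules, and they are not isomorphic as $T_f$-modules. -/

import Mathlib

open Matrix

namespace UniformStructure

noncomputable section

/-! Throughout, `X` is the finite vertex set of a graph and `X → ℂ` is the standard module. -/

variable {X : Type*} [Fintype X] [DecidableEq X]

open Classical in
/-- The adjacency matrix of `G`, with complex entries. -/
def adjacency (G : SimpleGraph X) : Matrix X X ℂ := G.adjMatrix ℂ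

/-- The eccentricity of the vertex `x`: the largest distance from `x`. -/
def eccentricity (G : SimpleGraph X) (x : X) : ℕ := Finset.univ.sup fun y => G.dist x y

/-- The `i`-th dual idempotent of `G` with respect to `x`
(it is the zero matrix when `i` exceeds the eccentricity of a connected graph). -/
def dualIdempotent (G : SimpleGraph X) (x : X) (i : ℕ) : Matrix X X ℂ :=
  Matrix.diagonal fun y => if G.dist x y = i then 1 else 0

/-- The Terwilliger algebra of `G` with respect to `x`: the algebra generated by the adjacency
matrix and the dual idempotents. -/
def terwilligerAlgebra (G : SimpleGraph X) (x : X) : Subalgebra ℂ (Matrix X X ℂ) :=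
  Algebra.adjoin ℂ ({adjacency G} ∪ Set.range (dualIdempotent G x))

/-- The lowering matrix of `G` with respect to `x`. -/
def lowering (G : SimpleGraph X) (x : X) : Matrix X X ℂ :=
  ∑ i ∈ Finset.Icc 1 (eccentricity G x),
    dualIdempotent G x (i - 1) * adjacency G * dualIdempotent G x i

/-- The raising matrix of `G` with respect to `x`. -/
def raising (G : SimpleGraph X) (x : X) : Matrix X X ℂ :=
  ∑ i ∈ Finset.range (eccentricity G x),
    dualIdempotent G x (i + 1) * adjacency G * dualIdempotent G x i

/-! ### Modules of the Terwilliger algebra -/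

/-- A `T`-module: a subspace of the standard module that is invariant under `T = T(x)`. -/
def IsTModule (G : SimpleGraph X) (x : X) (W : Submodule ℂ (X → ℂ)) : Prop :=
  ∀ B ∈ terwilligerAlgebra G x, ∀ w ∈ W, B *ᵥ w ∈ W

/-- An irreducible `T`-module. -/
def IsIrreducibleTModule (G : SimpleGraph X) (x : X) (W : Submodule ℂ (X → ℂ)) : Prop :=
  IsTModule G x W ∧ W ≠ ⊥ ∧ ∀ U : Submodule ℂ (X → ℂ), IsTModule G x U → U ≤ W → U = ⊥ ∨ U = W

/-- Two `T`-modules are `T`-isomorphic when some linear isomorphism between them commutes with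
the action of every `B ∈ T`. (For a `T`-module `W` the hypothesis `hBw` always holds.) -/
def IsTIsomorphic (G : SimpleGraph X) (x : X) (W W' : Submodule ℂ (X → ℂ)) : Prop :=
  ∃ σ : W ≃ₗ[ℂ] W', ∀ B ∈ terwilligerAlgebra G x, ∀ (w : X → ℂ) (hw : w ∈ W) (hBw : B *ᵥ w ∈ W),
    (σ ⟨B *ᵥ w, hBw⟩ : X → ℂ) = B *ᵥ (σ ⟨w, hw⟩ : X → ℂ)

/-- The set of all `i` with `E*ᵢ W ≠ 0`. -/
def dualSupport (G : SimpleGraph X) (x : X) (W : Submodule ℂ (X → ℂ)) : Set ℕ :=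
  {i | ∃ w ∈ W, dualIdempotent G x i *ᵥ w ≠ 0}

/-- The endpoint of `W`. -/
def endpoint (G : SimpleGraph X) (x : X) (W : Submodule ℂ (X → ℂ)) : ℕ :=
  sInf (dualSupport G x W)

/-- The diameter of `W`: the number of `i` with `E*ᵢ W ≠ 0`, minus one. -/
def moduleDiameter (G : SimpleGraph X) (x : X) (W : Submodule ℂ (X → ℂ)) : ℕ :=
  (dualSupport G x W).ncard - 1

open Classical in
/-- The finite set of distinct (real) eigenvalues of the adjacency matrix. -/
def eigenvalues (G : SimpleGraph X) : Finset ℝ :=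
  (Matrix.finite_real_spectrum (A := G.adjMatrix ℝ)).toFinset

/-- The primitive idempotent associated with the eigenvalue `θ`: the element of the adjacency
algebra obtained by evaluating at `A` the Lagrange polynomial that is `1` at `θ` and `0` at
every other eigenvalue, that is, the orthogonal projection onto the `θ`-eigenspace of `A`. -/
def primitiveIdempotent (G : SimpleGraph X) (θ : ℝ) : Matrix X X ℂ :=
  Polynomial.aeval (adjacency G) (Lagrange.basis (eigenvalues G) (fun η : ℝ => (η : ℂ)) θ)

/-- The position `i` of `θ = θᵢ` in the original (decreasing) ordering `θ₀ > θ₁ > ⋯` of the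
eigenvalues: the number of eigenvalues larger than `θ`. -/
def eigenvalueIndex (G : SimpleGraph X) (θ : ℝ) : ℕ :=
  ((eigenvalues G).filter fun η => θ < η).card

/-- The dual endpoint of `W` with respect to the original ordering of the primitive idempotents:
the least `i` with `Eᵢ W ≠ 0`. -/
def dualEndpoint (G : SimpleGraph X) (W : Submodule ℂ (X → ℂ)) : ℕ :=
  sInf {i | ∃ θ ∈ eigenvalues G, eigenvalueIndex G θ = i ∧
    ∃ w ∈ W, primitiveIdempotent G θ *ᵥ w ≠ 0}

/-- `W` is an irreducible `T`-module of endpoint `r`, diameter `d` and dual endpoint `t`. -/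
def IsIrreducibleOfType (G : SimpleGraph X) (x : X) (r d t : ℕ) (W : Submodule ℂ (X → ℂ)) : Prop :=
  IsIrreducibleTModule G x W ∧ endpoint G x W = r ∧ moduleDiameter G x W = d ∧
    dualEndpoint G W = t

/-! ### Uniform structures -/

/-- `U = (e i j)`, `1 ≤ i, j ≤ ε`, is a parameter matrix. The matrix is extended by zero to all
of `ℕ × ℕ`, so that `e⁻₁ = U 1 0 = 0` and `e⁺_ε = U ε (ε + 1) = 0`. -/
structure IsParameterMatrix (ε : ℕ) (U : Matrix ℕ ℕ ℂ) : Prop where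
  extended_by_zero : ∀ i j, ¬ (i ∈ Finset.Icc 1 ε ∧ j ∈ Finset.Icc 1 ε) → U i j = 0
  tridiagonal : ∀ i j, i + 1 < j ∨ j + 1 < i → U i j = 0
  diagonal_one : ∀ i ∈ Finset.Icc 1 ε, U i i = 1
  off_diagonal : (∀ i ∈ Finset.Icc 2 ε, U i (i - 1) ≠ 0) ∨ (∀ i ∈ Finset.Icc 2 ε, U (i - 1) i ≠ 0)
  principal_nonsingular : ∀ s t, 1 ≤ s → s ≤ t → t ≤ ε →
    (Matrix.of fun i j : Finset.Icc s t => U i j).det ≠ 0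

/-- `(U, f)` is a uniform structure of the (bipartite) graph `G` with respect to `x`; here
`e⁻ᵢ = U i (i - 1)` and `e⁺ᵢ = U i (i + 1)`. -/
def IsUniformStructure (G : SimpleGraph X) (x : X) (U : Matrix ℕ ℕ ℂ) (f : ℕ → ℂ) : Prop :=
  IsParameterMatrix (eccentricity G x) U ∧
  ∀ i ∈ Finset.Icc 1 (eccentricity G x), ∀ v : X → ℂ,
    (U i (i - 1) • (raising G x * lowering G x ^ 2)
      + lowering G x * raising G x * lowering G x
      + U i (i + 1) • (lowering G x ^ 2 * raising G x)) *ᵥ (dualIdempotent G x i *ᵥ v)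
    = (f i • lowering G x) *ᵥ (dualIdempotent G x i *ᵥ v)

/-- The graph `Γ_f`: remove from `G` all edges whose ends are equidistant from `x`. -/
def fullGraph (G : SimpleGraph X) (x : X) : SimpleGraph X where
  Adj y z := G.Adj y z ∧ G.dist x y ≠ G.dist x z
  symm := ⟨fun _ _ h => ⟨h.1.symm, h.2.symm⟩⟩
  loopless := ⟨fun _ h => h.2 rfl⟩

/-- `G` supports a uniform structure with respect to `x`: the graph `Γ_f` admits one. -/
def SupportsUniformStructure (G : SimpleGraph X) (x : X) : Prop :=
  ∃ (U : Matrix ℕ ℕ ℂ) (f : ℕ → ℂ), IsUniformStructure (fullGraph G x) x U f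

end

/-! ### Johnson graphs -/

/-- The vertices of `J(n, D)`: the `D`-element subsets of an `n`-element set. -/
abbrev JohnsonVertex (n D : ℕ) : Type := {s : Finset (Fin n) // s.card = D}

/-- The Johnson graph `J(n, D)`: two `D`-subsets are adjacent when they meet in `D - 1` elements. -/
def johnson (n D : ℕ) : SimpleGraph (JohnsonVertex n D) where
  Adj s t := (s.1 ∩ t.1).card + 1 = D
  symm := ⟨fun s t h => by rw [Finset.inter_comm]; exact h⟩
  loopless := ⟨fun s h => by rw [Finset.inter_self, s.2] at h; omega⟩

end UniformStructure

/-!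
Call `φ` a ladder when the adjacency matrix `A` maps every `E*ⱼ φ` to a combination of the `E*ᵢ φ`;
these vectors then span a module whose isomorphism class is determined by the coefficients of the
combination. Functions on the subsets of `Ω` that are harmonic of degree `a` on `x` and of degree
`b` on the complement of `x` restrict to ladders of `J(n, D)`, with coefficients that are quadratic
in `a` and in `b`. The ladder spans an irreducible module of endpoint `max a b` and dual endpoint
`a + b`. The latter holds because the lowering operator of the Boolean lattice preserves the
multiples of `φ`, and these vanish on the sets of fewer than `a + b` elements.

A uniform structure gives, for each ladder, one relation between its coefficients at level `i`.
Differences of the relations for `a, b ∈ {0, 1}` eliminate `f`. When `n > 2D` they are already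
inconsistent at level `2`; when `n = 2D` the contradiction comes from the middle levels.

A module of endpoint `1` contains an eigenvector of the graph induced on the neighbours of `x`, the
`D × (n - D)` rook's graph. As `D ≠ n - D`, the eigenspaces of the rook's graph are exactly the
spaces of functions of bidegree `(0, 0)`, `(1, 0)`, `(0, 1)` and `(1, 1)`, so the vector belongs to
a ladder. The diameter `D - 2` leaves the bidegrees `(1, 0)` and `(1, 1)`, and the product of the
two coefficients between levels `1` and `2` tells these apart even in `Γ_f`.
-/
namespace UniformStructure

noncomputable section

/-! ### Distances from the base vertex -/

section Distance

variable {X : Type*} {G : SimpleGraph X} {x : X}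

theorem dist_eq_of_level (l : X → ℕ) (h0 : ∀ y, l y = 0 ↔ y = x)
    (hle : ∀ y z, G.Adj y z → l z ≤ l y + 1)
    (hdown : ∀ y, l y ≠ 0 → ∃ z, G.Adj y z ∧ l z + 1 = l y) (y : X) : G.dist x y = l y := by
  have exists_walk (k : ℕ) (y : X) (hy : l y = k) : ∃ p : G.Walk x y, p.length = k := by
    induction k generalizing y with
    | zero =>
      obtain rfl := (h0 y).1 hy
      exact ⟨.nil, rfl⟩
    | succ k ih =>
      obtain ⟨z, hz, hl⟩ := hdown y (by lia)
      obtain ⟨p, hp⟩ := ih z (by lia)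
      exact ⟨p.concat hz.symm, by rw [SimpleGraph.Walk.length_concat, hp]⟩
  have level_le {u v : X} (p : G.Walk u v) : l v ≤ l u + p.length := by
    induction p with
    | nil => simp
    | cons h p ih =>
      have := hle _ _ h
      rw [SimpleGraph.Walk.length_cons]
      lia
  obtain ⟨p, hp⟩ := exists_walk _ y rfl
  obtain ⟨q, hq⟩ := p.reachable.exists_walk_length_eq_dist
  have hx : l x = 0 := (h0 x).2 rfl
  have hpq := level_le q
  have hdist := SimpleGraph.dist_le p
  lia

theorem exists_adj_dist_eq {y : X} {k : ℕ} (h : G.dist x y = k + 1) :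
    ∃ z, G.Adj z y ∧ G.dist x z = k ∧ G.Reachable x z := by
  have hr : G.Reachable x y := SimpleGraph.Reachable.of_dist_ne_zero (by lia)
  obtain ⟨p, hp⟩ := hr.symm.exists_walk_length_eq_dist
  rw [SimpleGraph.dist_comm, h] at hp
  cases p with
  | nil => simp at hp
  | @cons _ z _ hadj p =>
    rw [SimpleGraph.Walk.length_cons] at hp
    have hle := SimpleGraph.dist_le p.reverse
    rw [SimpleGraph.Walk.length_reverse] at hle
    have hz : G.Reachable x z := p.reverse.reachable
    obtain ⟨q, hq⟩ := hz.exists_walk_length_eq_dist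
    have hge := SimpleGraph.dist_le (q.concat hadj.symm)
    rw [SimpleGraph.Walk.length_concat] at hge
    exact ⟨z, hadj.symm, by lia, hz⟩

theorem exists_fullGraph_walk {y : X} (h : G.Reachable x y) :
    ∃ p : (fullGraph G x).Walk x y, p.length = G.dist x y := by
  induction hk : G.dist x y generalizing y with
  | zero =>
    obtain rfl := h.dist_eq_zero_iff.1 hk
    exact ⟨.nil, rfl⟩
  | succ k ih =>
    obtain ⟨z, hzy, hz, hr⟩ := exists_adj_dist_eq hk
    obtain ⟨p, hp⟩ := ih hr hz
    have hadj : (fullGraph G x).Adj z y := ⟨hzy, by lia⟩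
    exact ⟨p.concat hadj, by rw [SimpleGraph.Walk.length_concat, hp]⟩

theorem fullGraph_dist (G : SimpleGraph X) (x y : X) :
    (fullGraph G x).dist x y = G.dist x y := by
  have hle : fullGraph G x ≤ G := fun _ _ h => h.1
  by_cases h : G.Reachable x y
  · obtain ⟨p, hp⟩ := exists_fullGraph_walk h
    exact le_antisymm (hp ▸ SimpleGraph.dist_le p) (p.reachable.dist_anti hle)
  · rw [SimpleGraph.dist_eq_zero_of_not_reachable h,
      SimpleGraph.dist_eq_zero_of_not_reachable fun h' => h (h'.mono hle)]

theorem dist_le_eccentricity [Fintype X] (G : SimpleGraph X) (x y : X) :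
    G.dist x y ≤ eccentricity G x :=
  Finset.le_sup (f := G.dist x) (Finset.mem_univ y)

theorem dualIdempotent_fullGraph [DecidableEq X] (G : SimpleGraph X) (x : X) (i : ℕ) :
    dualIdempotent (fullGraph G x) x i = dualIdempotent G x i := by
  simp only [dualIdempotent, fullGraph_dist]

/-- Multiplication of `φ` by functions of the distance from `x`. -/
def radialMul (G : SimpleGraph X) (x : X) (φ : X → ℂ) : (ℕ → ℂ) →ₗ[ℂ] (X → ℂ) where
  toFun s y := s (G.dist x y) * φ y
  map_add' s t := by ext y; simp only [Pi.add_apply, add_mul]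
  map_smul' r s := by
    ext y
    simp only [Pi.smul_apply, smul_eq_mul, mul_assoc, RingHom.id_apply]

/-- The span of the vectors `E*ᵢ φ`. -/
abbrev radialSpan (G : SimpleGraph X) (x : X) (φ : X → ℂ) : Submodule ℂ (X → ℂ) :=
  LinearMap.range (radialMul G x φ)

theorem radialMul_apply (φ : X → ℂ) (s : ℕ → ℂ) (y : X) :
    radialMul G x φ s y = s (G.dist x y) * φ y := rfl

theorem self_mem_radialSpan (φ : X → ℂ) : φ ∈ radialSpan G x φ :=
  ⟨1, funext fun y => by rw [radialMul_apply, Pi.one_apply, one_mul]⟩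

theorem radialMul_fullGraph (G : SimpleGraph X) (x : X) (φ : X → ℂ) :
    radialMul (fullGraph G x) x φ = radialMul G x φ := by
  ext s y
  simp only [radialMul_apply, fullGraph_dist]

theorem radialSpan_fullGraph (G : SimpleGraph X) (x : X) (φ : X → ℂ) :
    radialSpan (fullGraph G x) x φ = radialSpan G x φ := by
  rw [radialSpan, radialMul_fullGraph]

end Distance

/-! ### Ladders and the modules they span -/

section Ladder

variable {X : Type*} [Fintype X] [DecidableEq X] {G : SimpleGraph X} {x : X}

theorem dualIdempotent_mulVec_apply (G : SimpleGraph X) (x : X) (i : ℕ) (v : X → ℂ) (y : X) :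
    (dualIdempotent G x i *ᵥ v) y = if G.dist x y = i then v y else 0 := by
  simp only [dualIdempotent, mulVec_diagonal, ite_mul, one_mul, zero_mul]

theorem dualIdempotent_mulVec_ne_zero_iff {i : ℕ} {v : X → ℂ} :
    dualIdempotent G x i *ᵥ v ≠ 0 ↔ ∃ y, G.dist x y = i ∧ v y ≠ 0 := by
  simp only [Function.ne_iff, dualIdempotent_mulVec_apply, Pi.zero_apply, ne_eq,
    ite_eq_right_iff, Classical.not_imp]

theorem dualIdempotent_mul_dualIdempotent (G : SimpleGraph X) (x : X) (i j : ℕ) :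
    dualIdempotent G x i * dualIdempotent G x j
      = if i = j then dualIdempotent G x i else 0 := by
  rw [dualIdempotent, dualIdempotent, diagonal_mul_diagonal]
  split_ifs with h
  · subst h
    exact congrArg diagonal (funext fun y => by split_ifs <;> simp)
  · rw [← diagonal_zero]
    exact congrArg diagonal (funext fun y => by split_ifs <;> lia)

theorem adjacency_mem_terwilligerAlgebra (G : SimpleGraph X) (x : X) :
    adjacency G ∈ terwilligerAlgebra G x :=
  Algebra.subset_adjoin (Or.inl rfl)

theorem dualIdempotent_mem_terwilligerAlgebra (G : SimpleGraph X) (x : X) (i : ℕ) :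
    dualIdempotent G x i ∈ terwilligerAlgebra G x :=
  Algebra.subset_adjoin (Or.inr ⟨i, rfl⟩)

theorem IsTModule.adjacency_mulVec_mem {W : Submodule ℂ (X → ℂ)} (h : IsTModule G x W)
    {w : X → ℂ} (hw : w ∈ W) : adjacency G *ᵥ w ∈ W :=
  h _ (adjacency_mem_terwilligerAlgebra G x) w hw

theorem IsTModule.dualIdempotent_mulVec_mem {W : Submodule ℂ (X → ℂ)} (h : IsTModule G x W)
    (i : ℕ) {w : X → ℂ} (hw : w ∈ W) : dualIdempotent G x i *ᵥ w ∈ W :=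
  h _ (dualIdempotent_mem_terwilligerAlgebra G x i) w hw

/-- `φ` is a ladder with coefficients `c` when `A (E*ⱼ φ) = ∑ᵢ c i j • E*ᵢ φ` for all `j`. -/
def IsLadder (G : SimpleGraph X) (x : X) (φ : X → ℂ) (c : ℕ → ℕ → ℂ) : Prop :=
  ∀ j, adjacency G *ᵥ (dualIdempotent G x j *ᵥ φ) = radialMul G x φ fun i => c i j

theorem dualIdempotent_mulVec_radialMul (i : ℕ) (φ : X → ℂ) (s : ℕ → ℂ) :
    dualIdempotent G x i *ᵥ radialMul G x φ s = s i • (dualIdempotent G x i *ᵥ φ) := by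
  ext y
  rw [dualIdempotent_mulVec_apply, radialMul_apply, Pi.smul_apply, dualIdempotent_mulVec_apply]
  split_ifs with h
  · rw [h, smul_eq_mul]
  · rw [smul_zero]

theorem radialMul_single (φ : X → ℂ) (i : ℕ) (r : ℂ) :
    radialMul G x φ (Pi.single i r) = r • (dualIdempotent G x i *ᵥ φ) := by
  ext y
  rw [radialMul_apply, Pi.single_apply, Pi.smul_apply, dualIdempotent_mulVec_apply, smul_eq_mul]
  split_ifs <;> simp

theorem radialMul_eq_sum (φ : X → ℂ) (s : ℕ → ℂ) :
    radialMul G x φ s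
      = ∑ j ∈ Finset.range (eccentricity G x + 1), s j • (dualIdempotent G x j *ᵥ φ) := by
  ext y
  have hy : G.dist x y ∈ Finset.range (eccentricity G x + 1) :=
    Finset.mem_range.2 (Nat.lt_succ_of_le (dist_le_eccentricity G x y))
  rw [Finset.sum_apply, Finset.sum_eq_single_of_mem _ hy]
  · rw [Pi.smul_apply, dualIdempotent_mulVec_apply, if_pos rfl, radialMul_apply, smul_eq_mul]
  · intro j _ hj
    rw [Pi.smul_apply, dualIdempotent_mulVec_apply, if_neg (Ne.symm hj), smul_zero]

theorem radialSpan_le {φ : X → ℂ} {U : Submodule ℂ (X → ℂ)}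
    (h : ∀ i, dualIdempotent G x i *ᵥ φ ∈ U) : radialSpan G x φ ≤ U := by
  rintro _ ⟨s, rfl⟩
  rw [radialMul_eq_sum]
  exact U.sum_mem fun j _ => U.smul_mem _ (h j)

theorem radialMul_eq_zero_iff {φ : X → ℂ} {s : ℕ → ℂ} :
    radialMul G x φ s = 0 ↔ ∀ i, dualIdempotent G x i *ᵥ φ ≠ 0 → s i = 0 := by
  constructor
  · intro h i hi
    have hsi := dualIdempotent_mulVec_radialMul (G := G) (x := x) i φ s
    rw [h, mulVec_zero, eq_comm, smul_eq_zero] at hsi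
    exact hsi.resolve_right hi
  · intro h
    rw [radialMul_eq_sum]
    refine Finset.sum_eq_zero fun j _ => smul_eq_zero.2 ?_
    by_cases hj : dualIdempotent G x j *ᵥ φ = 0
    · exact Or.inr hj
    · exact Or.inl (h j hj)

theorem dualSupport_radialSpan (φ : X → ℂ) :
    dualSupport G x (radialSpan G x φ) = {i | dualIdempotent G x i *ᵥ φ ≠ 0} := by
  ext i
  constructor
  · rintro ⟨_, ⟨s, rfl⟩, h⟩
    rw [dualIdempotent_mulVec_radialMul] at h
    exact right_ne_zero_of_smul h
  · exact fun h => ⟨φ, self_mem_radialSpan φ, h⟩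

theorem exists_linearEquiv_range {R M N : Type*} [Ring R] [AddCommGroup M] [Module R M]
    [AddCommGroup N] [Module R N] (f g : M →ₗ[R] N) (h : LinearMap.ker f = LinearMap.ker g) :
    ∃ σ : LinearMap.range f ≃ₗ[R] LinearMap.range g, ∀ m, σ (f.rangeRestrict m)
      = g.rangeRestrict m := by
  refine ⟨f.quotKerEquivRange.symm ≪≫ₗ Submodule.quotEquivOfEq _ _ h ≪≫ₗ g.quotKerEquivRange,
    fun m => ?_⟩
  have hm : f.quotKerEquivRange.symm (f.rangeRestrict m) = Submodule.Quotient.mk m := by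
    rw [LinearEquiv.symm_apply_eq]
    rfl
  rw [LinearEquiv.trans_apply, LinearEquiv.trans_apply, hm]
  rfl

namespace IsLadder

variable {φ φ' : X → ℂ} {c c' : ℕ → ℕ → ℂ}

theorem adjacency_mulVec_radialMul (h : IsLadder G x φ c) (s : ℕ → ℂ) :
    adjacency G *ᵥ radialMul G x φ s
      = radialMul G x φ
        (∑ j ∈ Finset.range (eccentricity G x + 1), s j • fun i => c i j) := by
  rw [radialMul_eq_sum, mulVec_sum, map_sum]
  exact Finset.sum_congr rfl fun j _ => by rw [mulVec_smul, h j, map_smul]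

theorem exists_mulVec_radialMul {B : Matrix X X ℂ} (hB : B ∈ terwilligerAlgebra G x)
    (c : ℕ → ℕ → ℂ) : ∃ τ : (ℕ → ℂ) → ℕ → ℂ, ∀ φ, IsLadder G x φ c →
      ∀ s, B *ᵥ radialMul G x φ s = radialMul G x φ (τ s) := by
  induction hB using Algebra.adjoin_induction with
  | mem B hB =>
    rcases hB with rfl | ⟨i, rfl⟩
    · exact ⟨_, fun φ h s => h.adjacency_mulVec_radialMul s⟩
    · exact ⟨_, fun φ _ s => by rw [dualIdempotent_mulVec_radialMul, ← radialMul_single]⟩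
  | algebraMap r =>
    exact ⟨_, fun φ _ s => by
      rw [Algebra.algebraMap_eq_smul_one, smul_mulVec, one_mulVec, ← map_smul]⟩
  | add B C _ _ hB hC =>
    obtain ⟨τ, hτ⟩ := hB
    obtain ⟨τ', hτ'⟩ := hC
    exact ⟨_, fun φ h s => by rw [add_mulVec, hτ φ h, hτ' φ h, ← map_add]⟩
  | mul B C _ _ hB hC =>
    obtain ⟨τ, hτ⟩ := hB
    obtain ⟨τ', hτ'⟩ := hC
    exact ⟨_, fun φ h s => by rw [← mulVec_mulVec, hτ' φ h, hτ φ h]⟩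

theorem isTModule (h : IsLadder G x φ c) : IsTModule G x (radialSpan G x φ) := by
  rintro B hB _ ⟨s, rfl⟩
  obtain ⟨τ, hτ⟩ := exists_mulVec_radialMul hB c
  exact ⟨τ s, (hτ φ h s).symm⟩

theorem isTIsomorphic (h : IsLadder G x φ c) (h' : IsLadder G x φ' c)
    (hs : ∀ i, dualIdempotent G x i *ᵥ φ ≠ 0 ↔ dualIdempotent G x i *ᵥ φ' ≠ 0) :
    IsTIsomorphic G x (radialSpan G x φ) (radialSpan G x φ') := by
  have hker : LinearMap.ker (radialMul G x φ) = LinearMap.ker (radialMul G x φ') := by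
    ext s
    rw [LinearMap.mem_ker, LinearMap.mem_ker, radialMul_eq_zero_iff, radialMul_eq_zero_iff]
    exact forall_congr' fun i => by rw [hs i]
  obtain ⟨σ, hσ⟩ := exists_linearEquiv_range _ _ hker
  refine ⟨σ, ?_⟩
  rintro B hB _ ⟨s, rfl⟩ hBs
  obtain ⟨τ, hτ⟩ := exists_mulVec_radialMul hB c
  have hBs' : (⟨B *ᵥ radialMul G x φ s, hBs⟩ : radialSpan G x φ)
      = (radialMul G x φ).rangeRestrict (τ s) := Subtype.ext (hτ φ h s)
  rw [hBs', hσ]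
  exact (hτ φ' h' s).symm.trans (congrArg (B *ᵥ ·) (congrArg Subtype.val (hσ s)).symm)

theorem dualIdempotent_mulVec_adjacency (h : IsLadder G x φ c) (i j : ℕ) :
    dualIdempotent G x i *ᵥ (adjacency G *ᵥ (dualIdempotent G x j *ᵥ φ))
      = c i j • (dualIdempotent G x i *ᵥ φ) := by
  rw [h j, dualIdempotent_mulVec_radialMul]

theorem dualIdempotent_mulVec_mem_of_coeff_ne_zero (h : IsLadder G x φ c)
    {U : Submodule ℂ (X → ℂ)} (hU : IsTModule G x U) {i j : ℕ} (hc : c i j ≠ 0)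
    (hj : dualIdempotent G x j *ᵥ φ ∈ U) : dualIdempotent G x i *ᵥ φ ∈ U := by
  have hi := hU.dualIdempotent_mulVec_mem i (hU.adjacency_mulVec_mem hj)
  rw [h.dualIdempotent_mulVec_adjacency] at hi
  exact (U.smul_mem_iff hc).1 hi

theorem radialSpan_le_of_mem (h : IsLadder G x φ c) {U : Submodule ℂ (X → ℂ)}
    (hU : IsTModule G x U) {r e k : ℕ}
    (hs : ∀ i, dualIdempotent G x i *ᵥ φ ≠ 0 ↔ i ∈ Set.Icc r e)
    (hup : ∀ i, r ≤ i → i < e → c (i + 1) i ≠ 0)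
    (hdown : ∀ i, r ≤ i → i < e → c i (i + 1) ≠ 0)
    (hk : k ∈ Set.Icc r e) (hkU : dualIdempotent G x k *ᵥ φ ∈ U) : radialSpan G x φ ≤ U := by
  have hr : dualIdempotent G x r *ᵥ φ ∈ U :=
    Nat.decreasingInduction' (P := fun i => dualIdempotent G x i *ᵥ φ ∈ U)
      (fun i hik hri hi => h.dualIdempotent_mulVec_mem_of_coeff_ne_zero hU
        (hdown i hri (hik.trans_le hk.2)) hi) hk.1 hkU
  have hmem (i : ℕ) (hri : r ≤ i) : i ≤ e → dualIdempotent G x i *ᵥ φ ∈ U := by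
    induction i, hri using Nat.le_induction with
    | base => exact fun _ => hr
    | succ i hri ih =>
      exact fun hie => h.dualIdempotent_mulVec_mem_of_coeff_ne_zero hU (hup i hri hie)
        (ih (Nat.le_of_succ_le hie))
  refine radialSpan_le fun i => ?_
  by_cases hi : dualIdempotent G x i *ᵥ φ = 0
  · exact hi ▸ U.zero_mem
  · obtain ⟨hri, hie⟩ := (hs i).1 hi
    exact hmem i hri hie

theorem isIrreducibleTModule (h : IsLadder G x φ c) {r e : ℕ} (hre : r ≤ e)
    (hs : ∀ i, dualIdempotent G x i *ᵥ φ ≠ 0 ↔ i ∈ Set.Icc r e)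
    (hup : ∀ i, r ≤ i → i < e → c (i + 1) i ≠ 0)
    (hdown : ∀ i, r ≤ i → i < e → c i (i + 1) ≠ 0) :
    IsIrreducibleTModule G x (radialSpan G x φ) := by
  refine ⟨h.isTModule, fun h0 => ?_, fun U hU hle => ?_⟩
  · have hφ : φ = 0 := (Submodule.mem_bot ℂ).1 (h0 ▸ self_mem_radialSpan (G := G) (x := x) φ)
    exact (hs r).2 ⟨le_rfl, hre⟩ (by rw [hφ, mulVec_zero])
  · refine or_iff_not_imp_left.2 fun hU0 => le_antisymm hle ?_
    obtain ⟨u, hu, hu0⟩ := (Submodule.ne_bot_iff U).1 hU0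
    obtain ⟨s, rfl⟩ := hle hu
    obtain ⟨k, hk, hsk⟩ : ∃ k, dualIdempotent G x k *ᵥ φ ≠ 0 ∧ s k ≠ 0 := by
      simpa only [ne_eq, radialMul_eq_zero_iff, not_forall, exists_prop] using hu0
    refine h.radialSpan_le_of_mem hU hs hup hdown ((hs k).1 hk) ((U.smul_mem_iff hsk).1 ?_)
    rw [← dualIdempotent_mulVec_radialMul]
    exact hU.dualIdempotent_mulVec_mem k hu

end IsLadder

theorem IsTIsomorphic.mulVec_eq_zero {W W' : Submodule ℂ (X → ℂ)} (h : IsTIsomorphic G x W W')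
    {C : Matrix X X ℂ} (hC : C ∈ terwilligerAlgebra G x) (hW : ∀ w ∈ W, C *ᵥ w = 0) :
    ∀ w ∈ W', C *ᵥ w = 0 := by
  obtain ⟨σ, hσ⟩ := h
  intro w hw
  obtain ⟨⟨v, hv⟩, hvw⟩ := σ.surjective ⟨w, hw⟩
  have hCv := hσ C hC v hv (hW v hv ▸ W.zero_mem)
  have hv0 : (⟨C *ᵥ v, hW v hv ▸ W.zero_mem⟩ : W) = 0 := Subtype.ext (hW v hv)
  rw [hvw, hv0, map_zero] at hCv
  exact hCv.symm

theorem IsLadder.coeff_mul_eq_of_isTIsomorphic {φ φ' : X → ℂ} {c c' : ℕ → ℕ → ℂ}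
    (h : IsLadder G x φ c) (h' : IsLadder G x φ' c')
    (hσ : IsTIsomorphic G x (radialSpan G x φ) (radialSpan G x φ')) {i : ℕ} (j : ℕ)
    (hi : dualIdempotent G x i *ᵥ φ' ≠ 0) : c' j i * c' i j = c j i * c i j := by
  set E := dualIdempotent G x
  set A := adjacency G
  have action {ψ : X → ℂ} {d : ℕ → ℕ → ℂ} (hψ : IsLadder G x ψ d) (s : ℕ → ℂ) :
      (E i * A * E j * A * E i - (c j i * c i j) • E i) *ᵥ radialMul G x ψ s
        = ((d j i * d i j - c j i * c i j) * s i) • (E i *ᵥ ψ) := by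
    simp only [sub_mulVec, smul_mulVec, ← mulVec_mulVec, E, A, dualIdempotent_mulVec_radialMul,
      mulVec_smul, hψ.dualIdempotent_mulVec_adjacency, smul_smul, ← sub_smul]
    ring_nf
  have hmem : E i * A * E j * A * E i - (c j i * c i j) • E i ∈ terwilligerAlgebra G x := by
    have hE := dualIdempotent_mem_terwilligerAlgebra G x
    have hA := adjacency_mem_terwilligerAlgebra G x
    exact sub_mem (mul_mem (mul_mem (mul_mem (mul_mem (hE i) hA) (hE j)) hA) (hE i))
      (Subalgebra.smul_mem _ (hE i) _)
  have hzero := hσ.mulVec_eq_zero hmem (by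
    rintro _ ⟨s, rfl⟩
    rw [action h, sub_self, zero_mul, zero_smul]) _ ⟨1, rfl⟩
  rw [action h', Pi.one_apply, mul_one] at hzero
  exact sub_eq_zero.1 ((smul_eq_zero.1 hzero).resolve_right hi)

/-! ### Uniform structures on ladders -/

theorem lowering_mul_dualIdempotent {j : ℕ} (hj : j < eccentricity G x) :
    lowering G x * dualIdempotent G x (j + 1)
      = dualIdempotent G x j * adjacency G * dualIdempotent G x (j + 1) := by
  rw [lowering, Finset.sum_mul, Finset.sum_eq_single_of_mem (j + 1)]
  · rw [mul_assoc, dualIdempotent_mul_dualIdempotent, if_pos rfl, Nat.add_sub_cancel]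
  · exact Finset.mem_Icc.2 ⟨Nat.le_add_left 1 j, hj⟩
  · intro i _ hi
    rw [mul_assoc, dualIdempotent_mul_dualIdempotent, if_neg hi, mul_zero]

theorem raising_mul_dualIdempotent {j : ℕ} (hj : j < eccentricity G x) :
    raising G x * dualIdempotent G x j
      = dualIdempotent G x (j + 1) * adjacency G * dualIdempotent G x j := by
  rw [raising, Finset.sum_mul, Finset.sum_eq_single_of_mem j (Finset.mem_range.2 hj)]
  · rw [mul_assoc, dualIdempotent_mul_dualIdempotent, if_pos rfl]
  · intro i _ hi
    rw [mul_assoc, dualIdempotent_mul_dualIdempotent, if_neg hi, mul_zero]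

namespace IsLadder

variable {φ : X → ℂ} {c : ℕ → ℕ → ℂ}

theorem lowering_mulVec (h : IsLadder G x φ c) {j : ℕ} (hj : j < eccentricity G x) :
    lowering G x *ᵥ (dualIdempotent G x (j + 1) *ᵥ φ)
      = c j (j + 1) • (dualIdempotent G x j *ᵥ φ) := by
  rw [mulVec_mulVec, lowering_mul_dualIdempotent hj, ← mulVec_mulVec, ← mulVec_mulVec,
    h.dualIdempotent_mulVec_adjacency]

theorem raising_mulVec (h : IsLadder G x φ c) {j : ℕ} (hj : j < eccentricity G x) :
    raising G x *ᵥ (dualIdempotent G x j *ᵥ φ)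
      = c (j + 1) j • (dualIdempotent G x (j + 1) *ᵥ φ) := by
  rw [mulVec_mulVec, raising_mul_dualIdempotent hj, ← mulVec_mulVec, ← mulVec_mulVec,
    h.dualIdempotent_mulVec_adjacency]

theorem uniform_relation (h : IsLadder G x φ c) {U : Matrix ℕ ℕ ℂ} {f : ℕ → ℂ}
    (hU : IsUniformStructure G x U f) {i : ℕ} (hi : i + 3 ≤ eccentricity G x)
    (hc : c (i + 1) (i + 2) ≠ 0) (hφ : dualIdempotent G x (i + 1) *ᵥ φ ≠ 0) :
    U (i + 2) (i + 1) * (c i (i + 1) * c (i + 1) i) + c (i + 1) (i + 2) * c (i + 2) (i + 1)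
      + U (i + 2) (i + 3) * (c (i + 2) (i + 3) * c (i + 3) (i + 2)) = f (i + 2) := by
  have hrel := hU.2 (i + 2) (Finset.mem_Icc.2 ⟨by lia, by lia⟩) φ
  rw [show i + 2 - 1 = i + 1 by lia, show i + 2 + 1 = i + 3 by lia] at hrel
  have h0 : i < eccentricity G x := by lia
  have h1 : i + 1 < eccentricity G x := by lia
  have h2 : i + 2 < eccentricity G x := by lia
  simp only [add_mulVec, smul_mulVec, pow_two, ← mulVec_mulVec, mulVec_smul,
    h.lowering_mulVec h0, h.lowering_mulVec h1, h.lowering_mulVec h2, h.raising_mulVec h0,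
    h.raising_mulVec h1, h.raising_mulVec h2, smul_smul, ← add_smul] at hrel
  apply mul_right_cancel₀ hc
  linear_combination smul_left_injective ℂ hφ hrel

end IsLadder

theorem adjacency_fullGraph_mulVec_dualIdempotent (j : ℕ) (v : X → ℂ) (y : X) :
    (adjacency (fullGraph G x) *ᵥ (dualIdempotent G x j *ᵥ v)) y
      = if G.dist x y = j then 0 else (adjacency G *ᵥ (dualIdempotent G x j *ᵥ v)) y := by
  simp only [adjacency, SimpleGraph.adjMatrix_mulVec_apply, dualIdempotent_mulVec_apply]
  split_ifs with hy
  · refine Finset.sum_eq_zero fun z hz => if_neg fun hzj => ?_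
    rw [SimpleGraph.mem_neighborFinset] at hz
    exact hz.2 (hy.trans hzj.symm)
  · rw [← Finset.sum_filter, ← Finset.sum_filter]
    refine Finset.sum_congr (Finset.ext fun z => ?_) fun _ _ => rfl
    simp only [Finset.mem_filter, SimpleGraph.mem_neighborFinset]
    exact ⟨fun h => ⟨h.1.1, h.2⟩, fun h => ⟨⟨h.1, fun hyz => hy (hyz.trans h.2)⟩, h.2⟩⟩

theorem IsLadder.fullGraph {φ : X → ℂ} {c : ℕ → ℕ → ℂ} (h : IsLadder G x φ c) :
    IsLadder (fullGraph G x) x φ fun i j => if i = j then 0 else c i j := by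
  intro j
  ext y
  rw [dualIdempotent_fullGraph, adjacency_fullGraph_mulVec_dualIdempotent, h j,
    radialMul_fullGraph, radialMul_apply, radialMul_apply, ite_mul, zero_mul]

end Ladder

/-! ### The spectrum of a graph -/

section Spectrum

theorem adjacency_isHermitian {X : Type*} (G : SimpleGraph X) : (adjacency G).IsHermitian := by
  classical exact G.isHermitian_adjMatrix ℂ

theorem exists_sum_eigenvectors {X : Type*} [Fintype X] (G : SimpleGraph X) (w : X → ℂ) :
    ∃ (u : X → X → ℂ) (μ : X → ℝ), w = ∑ i, u i ∧
      ∀ i, adjacency G *ᵥ u i = (μ i : ℂ) • u i := by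
  classical
  have hA := adjacency_isHermitian G
  refine ⟨fun i => hA.eigenvectorBasis.repr (WithLp.toLp 2 w) i •
    WithLp.ofLp (hA.eigenvectorBasis i), hA.eigenvalues, ?_, fun i => ?_⟩
  · have hsum := congrArg WithLp.ofLp (hA.eigenvectorBasis.sum_repr (WithLp.toLp 2 w))
    rw [WithLp.ofLp_sum] at hsum
    exact hsum.symm
  · rw [mulVec_smul, hA.mulVec_eigenvectorBasis i, smul_comm]
    rfl

variable {X : Type*} [Fintype X] [DecidableEq X] {G : SimpleGraph X} {x : X}

theorem mem_eigenvalues_iff {θ : ℝ} :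
    θ ∈ eigenvalues G ↔ ∃ v : X → ℂ, v ≠ 0 ∧ adjacency G *ᵥ v = (θ : ℂ) • v := by
  classical
  have hmap : (algebraMap ℝ (Matrix X X ℝ) θ - G.adjMatrix ℝ).map (algebraMap ℝ ℂ)
      = algebraMap ℂ (Matrix X X ℂ) θ - adjacency G := by
    ext y z
    simp only [adjacency, map_apply, Matrix.sub_apply, SimpleGraph.adjMatrix_apply,
      algebraMap_matrix_apply]
    split_ifs <;> simp
  have hdet : (algebraMap ℝ (Matrix X X ℝ) θ - G.adjMatrix ℝ).det = 0
      ↔ (algebraMap ℂ (Matrix X X ℂ) θ - adjacency G).det = 0 := by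
    rw [← hmap, ← RingHom.mapMatrix_apply, ← RingHom.map_det, map_eq_zero]
  rw [eigenvalues, Set.Finite.mem_toFinset, spectrum.mem_iff, isUnit_iff_isUnit_det,
    isUnit_iff_ne_zero, not_not, hdet, ← exists_mulVec_eq_zero_iff]
  refine exists_congr fun v => and_congr_right fun _ => ?_
  rw [sub_mulVec, Algebra.algebraMap_eq_smul_one, smul_mulVec, one_mulVec, sub_eq_zero, eq_comm]

theorem aeval_mulVec_of_mulVec_eq_smul {M : Matrix X X ℂ} {v : X → ℂ} {μ : ℂ}
    (h : M *ᵥ v = μ • v) (p : Polynomial ℂ) : Polynomial.aeval M p *ᵥ v = p.eval μ • v := by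
  have hp : toLinAlgEquiv' (Polynomial.aeval M p) = Polynomial.aeval (toLinAlgEquiv' M) p :=
    (Polynomial.aeval_algHom_apply (toLinAlgEquiv' (R := ℂ)) M p).symm
  rw [← toLinAlgEquiv'_apply, hp]
  exact Module.End.aeval_apply_of_mem_apply_eq_smul (p := p) h

theorem primitiveIdempotent_mulVec_of_eigenvector {v : X → ℂ} {μ θ : ℝ} (hθ : θ ∈ eigenvalues G)
    (h : adjacency G *ᵥ v = (μ : ℂ) • v) :
    primitiveIdempotent G θ *ᵥ v = if μ = θ then v else 0 := by
  by_cases hv : v = 0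
  · rw [hv, mulVec_zero, ite_self]
  have hμ : μ ∈ eigenvalues G := mem_eigenvalues_iff.2 ⟨v, hv, h⟩
  rw [primitiveIdempotent, aeval_mulVec_of_mulVec_eq_smul h]
  split_ifs with hμθ
  · rw [hμθ, Lagrange.eval_basis_self Complex.ofReal_injective.injOn hθ, one_smul]
  · rw [Lagrange.eval_basis_of_ne (v := fun η : ℝ => (η : ℂ)) (Ne.symm hμθ) hμ, zero_smul]

theorem adjacency_mulVec_primitiveIdempotent {θ : ℝ} (hθ : θ ∈ eigenvalues G) (w : X → ℂ) :
    adjacency G *ᵥ (primitiveIdempotent G θ *ᵥ w)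
      = (θ : ℂ) • (primitiveIdempotent G θ *ᵥ w) := by
  obtain ⟨u, μ, rfl, hu⟩ := exists_sum_eigenvectors G w
  rw [mulVec_sum, mulVec_sum, Finset.smul_sum]
  refine Finset.sum_congr rfl fun i _ => ?_
  rw [primitiveIdempotent_mulVec_of_eigenvector hθ (hu i)]
  split_ifs with h
  · rw [hu, h]
  · rw [mulVec_zero, smul_zero]

theorem primitiveIdempotent_mem_terwilligerAlgebra (G : SimpleGraph X) (x : X) (θ : ℝ) :
    primitiveIdempotent G θ ∈ terwilligerAlgebra G x :=
  Algebra.adjoin_mono (s := {adjacency G}) Set.subset_union_left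
    (Polynomial.aeval_mem_adjoin_singleton ℂ (adjacency G))

theorem dualEndpoint_eq {W : Submodule ℂ (X → ℂ)} (hW : IsTModule G x W) {v : X → ℂ}
    (hv : v ∈ W) (hv0 : v ≠ 0) {μ : ℝ} (h : adjacency G *ᵥ v = (μ : ℂ) • v)
    (hmin : ∀ w ∈ W, w ≠ 0 → ∀ θ : ℝ, adjacency G *ᵥ w = (θ : ℂ) • w →
      eigenvalueIndex G μ ≤ eigenvalueIndex G θ) : dualEndpoint G W = eigenvalueIndex G μ := by
  have hμ : μ ∈ eigenvalues G := mem_eigenvalues_iff.2 ⟨v, hv0, h⟩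
  have hvμ : primitiveIdempotent G μ *ᵥ v ≠ 0 := by
    rwa [primitiveIdempotent_mulVec_of_eigenvector hμ h, if_pos rfl]
  refine le_antisymm (Nat.sInf_le ⟨μ, hμ, rfl, v, hv, hvμ⟩)
    (le_csInf ⟨_, μ, hμ, rfl, v, hv, hvμ⟩ ?_)
  rintro _ ⟨θ, hθ, rfl, w, hw, hw0⟩
  exact hmin _ (hW _ (primitiveIdempotent_mem_terwilligerAlgebra G x θ) w hw) hw0 θ
    (adjacency_mulVec_primitiveIdempotent hθ w)

end Spectrum

/-! ### Harmonic functions on the Boolean lattice -/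

section Harmonic

variable {α R : Type*} [DecidableEq α] [CommRing R] {s t : Finset α} {a b : ℕ}
  {φ ψ : Finset α → R}

/-- A function on finsets is harmonic of degree `a` on `s` when adding, respectively removing, an
element of `s` acts on it as on the isotypic component of type `(|s| - a, a)`. -/
structure IsHarmonic (s : Finset α) (a : ℕ) (φ : Finset α → R) : Prop where
  sum_insert : ∀ z, ∑ j ∈ s \ z, φ (insert j z) = ((s \ z).card - a) * φ z
  sum_erase : ∀ z, ∑ j ∈ s ∩ z, φ (z.erase j) = ((s ∩ z).card - a) * φ z

/-- `f z` depends only on the part of `z` outside `s`. -/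
def IsInvariant {β : Type*} (s : Finset α) (f : Finset α → β) : Prop := ∀ z, f (z \ s) = f z

theorem isInvariant_inter (h : Disjoint t s) : IsInvariant s fun z => t ∩ z := fun z => by
  change t ∩ (z \ s) = t ∩ z
  rw [← Finset.inter_sdiff_assoc, Finset.sdiff_eq_self_of_disjoint
    (h.mono_left Finset.inter_subset_left)]

theorem isInvariant_of_inter_eq {β : Type*} {f : Finset α → β} (h : Disjoint t s)
    (hf : ∀ z, f (t ∩ z) = f z) : IsInvariant s f := fun z => by
  rw [← hf, ← hf z]
  exact congrArg f (isInvariant_inter h z)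

theorem IsInvariant.insert {β : Type*} {f : Finset α → β} (hf : IsInvariant s f) {j : α}
    (hj : j ∈ s) (z : Finset α) : f (insert j z) = f z := by
  rw [← hf, Finset.insert_sdiff_of_mem _ hj, hf]

theorem IsInvariant.erase {β : Type*} {f : Finset α → β} (hf : IsInvariant s f) {j : α}
    (hj : j ∈ s) (z : Finset α) : f (z.erase j) = f z := by
  rw [← hf, Finset.erase_sdiff_comm, Finset.erase_eq_of_notMem
    fun h => (Finset.mem_sdiff.1 h).2 hj, hf]

theorem IsInvariant.isHarmonic_zero (hφ : IsInvariant s φ) : IsHarmonic s 0 φ where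
  sum_insert z := by
    rw [Finset.sum_congr rfl fun j hj => hφ.insert (Finset.mem_sdiff.1 hj).1 z, Finset.sum_const,
      nsmul_eq_mul, Nat.cast_zero, sub_zero]
  sum_erase z := by
    rw [Finset.sum_congr rfl fun j hj => hφ.erase (Finset.mem_inter.1 hj).1 z, Finset.sum_const,
      nsmul_eq_mul, Nat.cast_zero, sub_zero]

theorem isHarmonic_one_sum {m : α → Finset α → R} (hm : ∀ k, IsInvariant s (m k))
    (hsum : ∀ z, ∑ k ∈ s, m k z = 0) : IsHarmonic s 1 fun z => ∑ k ∈ s ∩ z, m k z where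
  sum_insert z := by
    have hterm : ∀ j ∈ s \ z, ∑ k ∈ s ∩ insert j z, m k (insert j z)
        = m j z + ∑ k ∈ s ∩ z, m k z := fun j hj => by
      obtain ⟨hjs, hjz⟩ := Finset.mem_sdiff.1 hj
      rw [Finset.inter_insert_of_mem hjs, Finset.sum_insert fun h => hjz (Finset.mem_inter.1 h).2,
        (hm j).insert hjs, Finset.sum_congr rfl fun k _ => (hm k).insert hjs z]
    have hrest : ∑ j ∈ s \ z, m j z = -∑ k ∈ s ∩ z, m k z := by
      rw [eq_neg_iff_add_eq_zero, add_comm, Finset.sum_inter_add_sum_sdiff, hsum]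
    rw [Finset.sum_congr rfl hterm, Finset.sum_add_distrib, Finset.sum_const, nsmul_eq_mul, hrest,
      Nat.cast_one]
    ring
  sum_erase z := by
    have hterm : ∀ j ∈ s ∩ z, ∑ k ∈ s ∩ z.erase j, m k (z.erase j)
        = ∑ k ∈ s ∩ z, m k z - m j z := fun j hj => by
      rw [Finset.inter_erase, ← Finset.add_sum_erase _ _ hj, add_sub_cancel_left]
      exact Finset.sum_congr rfl fun k _ => (hm k).erase (Finset.mem_inter.1 hj).1 z
    rw [Finset.sum_congr rfl hterm, Finset.sum_sub_distrib, Finset.sum_const, nsmul_eq_mul,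
      Nat.cast_one]
    ring

namespace IsHarmonic

theorem invariant_mul (h : IsHarmonic s a φ) (hψ : IsInvariant s ψ) :
    IsHarmonic s a fun z => ψ z * φ z where
  sum_insert z := by
    rw [Finset.sum_congr rfl fun j hj => by rw [hψ.insert (Finset.mem_sdiff.1 hj).1],
      ← Finset.mul_sum, h.sum_insert]
    ring
  sum_erase z := by
    rw [Finset.sum_congr rfl fun j hj => by rw [hψ.erase (Finset.mem_inter.1 hj).1],
      ← Finset.mul_sum, h.sum_erase]
    ring

theorem union (hs : IsHarmonic s a φ) (ht : IsHarmonic t b φ) (hst : Disjoint s t) :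
    IsHarmonic (s ∪ t) (a + b) φ where
  sum_insert z := by
    have hd : Disjoint (s \ z) (t \ z) := hst.mono Finset.sdiff_subset Finset.sdiff_subset
    rw [Finset.union_sdiff_distrib, Finset.sum_union hd, hs.sum_insert, ht.sum_insert,
      Finset.card_union_of_disjoint hd]
    push_cast
    ring
  sum_erase z := by
    have hd : Disjoint (s ∩ z) (t ∩ z) := hst.mono Finset.inter_subset_left Finset.inter_subset_left
    rw [Finset.union_inter_distrib_right, Finset.sum_union hd, hs.sum_erase, ht.sum_erase,
      Finset.card_union_of_disjoint hd]
    push_cast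
    ring

theorem sum_swap_self (h : IsHarmonic s a φ) (z : Finset α) :
    ∑ j ∈ s ∩ z, ∑ k ∈ s \ z, φ (insert k (z.erase j))
      = (((s \ z).card + 1 - a) * ((s ∩ z).card - a) - (s ∩ z).card) * φ z := by
  have hterm : ∀ j ∈ s ∩ z, ∑ k ∈ s \ z, φ (insert k (z.erase j))
      = ((s \ z).card + 1 - a) * φ (z.erase j) - φ z := fun j hj => by
    obtain ⟨hjs, hjz⟩ := Finset.mem_inter.1 hj
    have hj' : j ∉ s \ z := fun h => (Finset.mem_sdiff.1 h).2 hjz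
    have hsum := h.sum_insert (z.erase j)
    rw [Finset.sdiff_erase hjs, Finset.sum_insert hj', Finset.insert_erase hjz,
      Finset.card_insert_of_notMem hj', Nat.cast_succ] at hsum
    linear_combination hsum
  rw [Finset.sum_congr rfl hterm, Finset.sum_sub_distrib, ← Finset.mul_sum, h.sum_erase,
    Finset.sum_const, nsmul_eq_mul]
  ring

theorem sum_swap (hs : IsHarmonic s a φ) (ht : IsHarmonic t b φ) (hst : Disjoint s t)
    (z : Finset α) :
    ∑ j ∈ s ∩ z, ∑ k ∈ t \ z, φ (insert k (z.erase j))
      = ((t \ z).card - b) * ((s ∩ z).card - a) * φ z := by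
  have hterm : ∀ j ∈ s ∩ z, ∑ k ∈ t \ z, φ (insert k (z.erase j))
      = ((t \ z).card - b) * φ (z.erase j) := fun j hj => by
    have hjt : j ∉ t := Finset.disjoint_left.1 hst (Finset.mem_inter.1 hj).1
    have hsdiff : t \ z.erase j = t \ z := by grind
    rw [← hsdiff]
    exact ht.sum_insert (z.erase j)
  rw [Finset.sum_congr rfl hterm, ← Finset.mul_sum, hs.sum_erase]
  ring

section Support

variable [CharZero R] [NoZeroDivisors R]

theorem exists_insert_ne_zero (h : IsHarmonic s a φ) {z : Finset α} (hz : φ z ≠ 0)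
    (ha : (s \ z).card ≠ a) : ∃ j ∈ s \ z, φ (insert j z) ≠ 0 := by
  refine Finset.exists_ne_zero_of_sum_ne_zero ?_
  rw [h.sum_insert]
  exact mul_ne_zero (sub_ne_zero.2 (Nat.cast_injective.ne ha)) hz

theorem exists_erase_ne_zero (h : IsHarmonic s a φ) {z : Finset α} (hz : φ z ≠ 0)
    (ha : (s ∩ z).card ≠ a) : ∃ j ∈ s ∩ z, φ (z.erase j) ≠ 0 := by
  refine Finset.exists_ne_zero_of_sum_ne_zero ?_
  rw [h.sum_erase]
  exact mul_ne_zero (sub_ne_zero.2 (Nat.cast_injective.ne ha)) hz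

theorem le_card_sdiff (h : IsHarmonic s a φ) {z : Finset α} (hz : φ z ≠ 0) :
    a ≤ (s \ z).card := by
  induction hk : (s \ z).card generalizing z with
  | zero =>
    by_contra! ha
    obtain ⟨j, hj, -⟩ := h.exists_insert_ne_zero hz (by lia)
    exact Finset.card_ne_zero_of_mem hj hk
  | succ k ih =>
    by_contra! ha
    obtain ⟨j, hj, hjz⟩ := h.exists_insert_ne_zero hz (by lia)
    have := ih hjz (by rw [Finset.sdiff_insert, Finset.card_erase_of_mem hj, hk,
      Nat.add_sub_cancel])
    lia

theorem le_card_inter (h : IsHarmonic s a φ) {z : Finset α} (hz : φ z ≠ 0) :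
    a ≤ (s ∩ z).card := by
  induction hk : (s ∩ z).card generalizing z with
  | zero =>
    by_contra! ha
    obtain ⟨j, hj, -⟩ := h.exists_erase_ne_zero hz (by lia)
    exact Finset.card_ne_zero_of_mem hj hk
  | succ k ih =>
    by_contra! ha
    obtain ⟨j, hj, hjz⟩ := h.exists_erase_ne_zero hz (by lia)
    have := ih hjz (by rw [Finset.inter_erase, Finset.card_erase_of_mem hj, hk,
      Nat.add_sub_cancel])
    lia

theorem exists_card_inter_eq (h : IsHarmonic s a φ) {z : Finset α} (hz : φ z ≠ 0) {m : ℕ}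
    (ham : a ≤ m) (hm : m + a ≤ s.card) :
    ∃ w, φ w ≠ 0 ∧ w \ s = z \ s ∧ (s ∩ w).card = m := by
  obtain hmz | hmz := le_total (s ∩ z).card m
  · induction m, hmz using Nat.le_induction with
    | base => exact ⟨z, hz, rfl, rfl⟩
    | succ k hk ih =>
      obtain ⟨w, hw, hwz, hwk⟩ := ih ((h.le_card_inter hz).trans hk) (by lia)
      obtain ⟨j, hj, hjw⟩ := h.exists_insert_ne_zero hw (by
        have := Finset.card_sdiff_add_card_inter s w
        lia)
      obtain ⟨hjs, hj⟩ := Finset.mem_sdiff.1 hj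
      refine ⟨insert j w, hjw, by rw [Finset.insert_sdiff_of_mem _ hjs, hwz], ?_⟩
      rw [Finset.inter_insert_of_mem hjs, Finset.card_insert_of_notMem (by grind), hwk]
  · induction hd : (s ∩ z).card - m generalizing z with
    | zero => exact ⟨z, hz, rfl, by lia⟩
    | succ d ih =>
      obtain ⟨j, hj, hjz⟩ := h.exists_erase_ne_zero hz (by lia)
      have hcard : (s ∩ z.erase j).card = (s ∩ z).card - 1 := by
        rw [Finset.inter_erase, Finset.card_erase_of_mem hj]
      obtain ⟨w, hw, hwz, hwm⟩ := ih hjz (by lia) (by lia)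
      have hjs : j ∈ s := (Finset.mem_inter.1 hj).1
      exact ⟨w, hw, by grind, hwm⟩

end Support

end IsHarmonic

theorem exists_isHarmonic [Nontrivial R] (h : 2 * a ≤ s.card) :
    ∃ φ : Finset α → R, IsHarmonic s a φ ∧ (∀ z, φ (s ∩ z) = φ z) ∧ ∃ z, φ z ≠ 0 := by
  induction a generalizing s with
  | zero => exact ⟨1, IsInvariant.isHarmonic_zero fun _ => rfl, fun _ => rfl, ∅, one_ne_zero⟩
  | succ a ih =>
    obtain ⟨p, hp, q, hq, hpq⟩ := Finset.one_lt_card.1 (by lia : 1 < s.card)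
    have hsub : {p, q} ⊆ s := by grind
    have hcard : (s \ {p, q}).card = s.card - 2 := by
      rw [Finset.card_sdiff_of_subset hsub, Finset.card_pair hpq]
    have hp_inter (z : Finset α) : {p, q} ∩ insert p ((s \ {p, q}) ∩ z) = {p} := by
      ext i
      simp only [Finset.mem_inter, Finset.mem_insert, Finset.mem_sdiff, Finset.mem_singleton]
      tauto
    obtain ⟨φ, hφ, hφs, w, hw⟩ := ih (s := s \ {p, q}) (by lia)
    let m (k : α) (_ : Finset α) : R := if k = p then 1 else -1
    let χ (z : Finset α) : R := ∑ k ∈ {p, q} ∩ z, m k z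
    have hχ : IsHarmonic {p, q} 1 χ := isHarmonic_one_sum (fun _ _ => rfl) fun z => by
      simp only [m, Finset.sum_pair hpq, if_pos, if_neg hpq.symm, add_neg_cancel]
    have hχ_inv : IsInvariant (s \ {p, q}) χ := isInvariant_of_inter_eq disjoint_sdiff_self_right
      fun z => by simp only [χ, m, ← Finset.inter_assoc, Finset.inter_self]
    have hφ_inv : IsInvariant {p, q} φ := isInvariant_of_inter_eq disjoint_sdiff_self_left hφs
    refine ⟨fun z => χ z * φ z, ?_, fun z => ?_, insert p ((s \ {p, q}) ∩ w), ?_⟩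
    · rw [← Finset.sdiff_union_of_subset hsub]
      refine (hφ.invariant_mul hχ_inv).union ?_ Finset.sdiff_disjoint
      simpa only [mul_comm] using hχ.invariant_mul hφ_inv
    · have hφz : φ (s ∩ z) = φ z := by
        rw [← hφs, ← Finset.inter_assoc, Finset.inter_eq_left.2 Finset.sdiff_subset, hφs]
      simp only [χ, m, ← Finset.inter_assoc, Finset.inter_eq_left.2 hsub, hφz]
    · simp only [χ, m, hp_inter, Finset.sum_singleton, if_pos, one_mul]
      rwa [hφ_inv.insert (Finset.mem_insert_self p _), hφs]

end Harmonic

/-! ### Operators on the Boolean lattice -/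

theorem card_inter_insert_erase {α : Type*} [DecidableEq α] (s : Finset α) {z : Finset α} {j k : α}
    (hj : j ∈ z) (hk : k ∉ z) :
    (s ∩ insert k (z.erase j)).card + (if j ∈ s then 1 else 0)
      = (s ∩ z).card + if k ∈ s then 1 else 0 := by
  have hjk : k ∉ s ∩ z.erase j := fun h => hk (Finset.mem_of_mem_erase (Finset.mem_inter.1 h).2)
  have hcard : (s ∩ z.erase j).card + (if j ∈ s then 1 else 0) = (s ∩ z).card := by
    rw [Finset.inter_erase]
    split_ifs with hjs
    · exact Finset.card_erase_add_one (Finset.mem_inter.2 ⟨hjs, hj⟩)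
    · rw [Finset.erase_eq_of_notMem fun h => hjs (Finset.mem_inter.1 h).1, add_zero]
  rw [← hcard]
  by_cases hks : k ∈ s
  · rw [Finset.inter_insert_of_mem hks, Finset.card_insert_of_notMem hjk, if_pos hks]
    ring
  · rw [Finset.inter_insert_of_notMem hks, if_neg hks, add_zero]

section BooleanLattice

variable {α R : Type*} [Fintype α] [DecidableEq α] [CommRing R] {s : Finset α} {a b : ℕ}
  {φ : Finset α → R}

/-- The lowering operator of the Boolean lattice: it carries functions on `(k + 1)`-sets to
functions on `k`-sets. -/
def booleanDown (f : Finset α → R) (z : Finset α) : R := ∑ k ∈ zᶜ, f (insert k z)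

/-- The raising operator of the Boolean lattice: it carries functions on `k`-sets to functions on
`(k + 1)`-sets. -/
def booleanUp (f : Finset α → R) (z : Finset α) : R := ∑ j ∈ z, f (z.erase j)

/-- The exchange operator of the Boolean lattice, which acts on the functions on `k`-sets as the
adjacency operator of a Johnson graph. -/
def exchange (f : Finset α → R) (z : Finset α) : R :=
  ∑ j ∈ z, ∑ k ∈ zᶜ, f (insert k (z.erase j))

theorem booleanUp_booleanDown (f : Finset α → R) (z : Finset α) :
    booleanUp (booleanDown f) z = z.card * f z + exchange f z := by
  have hterm : ∀ j ∈ z, booleanDown f (z.erase j) = f z + ∑ k ∈ zᶜ, f (insert k (z.erase j)) :=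
    fun j hj => by
      rw [booleanDown, Finset.compl_erase,
        Finset.sum_insert fun h => Finset.mem_compl.1 h hj, Finset.insert_erase hj]
  rw [booleanUp, Finset.sum_congr rfl hterm, Finset.sum_add_distrib, Finset.sum_const,
    nsmul_eq_mul, exchange]

theorem booleanDown_booleanUp (f : Finset α → R) (z : Finset α) :
    booleanDown (booleanUp f) z
      = booleanUp (booleanDown f) z + (Fintype.card α - 2 * z.card) * f z := by
  have hterm : ∀ k ∈ zᶜ, booleanUp f (insert k z) = f z + ∑ j ∈ z, f (insert k (z.erase j)) :=
    fun k hk => by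
      have hkz := Finset.mem_compl.1 hk
      rw [booleanUp, Finset.sum_insert hkz, Finset.erase_insert hkz]
      exact congrArg _ (Finset.sum_congr rfl fun j hj => by
        rw [Finset.erase_insert_of_ne (ne_of_mem_of_not_mem hj hkz).symm])
  rw [booleanUp_booleanDown, exchange, booleanDown, Finset.sum_congr rfl hterm,
    Finset.sum_add_distrib, Finset.sum_const, nsmul_eq_mul, Finset.sum_comm, Finset.card_compl,
    Nat.cast_sub (Finset.card_le_univ z)]
  ring

-- Lower `f` until it vanishes: by the commutation relation it stays an eigenvector on the way,
-- and the last nonzero function, on level `j`, is killed by `booleanDown`.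
theorem exists_level_of_booleanUp_booleanDown_eq [NoZeroDivisors R] {S : Set (Finset α → R)}
    (hS : ∀ f ∈ S, booleanDown f ∈ S) {k : ℕ} {f : Finset α → R} {μ : R} (hfS : f ∈ S)
    (hf : f ≠ 0) (hk : ∀ z, f z ≠ 0 → z.card = k) (hμ : booleanUp (booleanDown f) = μ • f) :
    ∃ j ≤ k, μ = (k - j) * (Fintype.card α - j - k + 1) ∧ ∃ g ∈ S, ∃ z, z.card = j ∧ g z ≠ 0 := by
  induction k generalizing f μ with
  | zero =>
    obtain ⟨z, hz⟩ := Function.ne_iff.1 hf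
    have hz0 : z = ∅ := Finset.card_eq_zero.1 (hk z hz)
    have hμz : 0 = μ * f z := by
      simpa only [hz0, booleanUp, Finset.sum_empty, Pi.smul_apply, smul_eq_mul] using congrFun hμ z
    refine ⟨0, le_rfl, ?_, f, hfS, z, hk z hz, hz⟩
    rw [(mul_eq_zero.1 hμz.symm).resolve_right hz, sub_self, zero_mul]
  | succ k ih =>
    by_cases hg : booleanDown f = 0
    · obtain ⟨z, hz⟩ := Function.ne_iff.1 hf
      have hμz : 0 = μ * f z := by
        simpa only [hg, booleanUp, Pi.zero_apply, Finset.sum_const_zero, Pi.smul_apply, smul_eq_mul]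
          using congrFun hμ z
      refine ⟨k + 1, le_rfl, ?_, f, hfS, z, hk z hz, hz⟩
      rw [(mul_eq_zero.1 hμz.symm).resolve_right hz, sub_self, zero_mul]
    · have hlevel : ∀ z, booleanDown f z ≠ 0 → z.card = k := fun z hz => by
        obtain ⟨l, hl, hlz⟩ := Finset.exists_ne_zero_of_sum_ne_zero hz
        have := hk _ hlz
        rwa [Finset.card_insert_of_notMem (Finset.mem_compl.1 hl), Nat.add_right_cancel_iff] at this
      have hμ' : booleanUp (booleanDown (booleanDown f))
          = (μ - (Fintype.card α - 2 * k)) • booleanDown f := by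
        ext z
        have hcomm := booleanDown_booleanUp (booleanDown f) z
        have hdown : booleanDown (μ • f) z = μ * booleanDown f z := (Finset.mul_sum ..).symm
        rw [hμ, hdown] at hcomm
        rw [Pi.smul_apply, smul_eq_mul]
        obtain hz | hz := eq_or_ne (booleanDown f z) 0
        · rw [hz] at hcomm ⊢
          linear_combination -hcomm
        · rw [hlevel z hz] at hcomm
          linear_combination -hcomm
      obtain ⟨j, hj, hμj, hex⟩ := ih (hS f hfS) hg hlevel hμ'
      refine ⟨j, by lia, ?_, hex⟩
      push_cast
      linear_combination hμj

theorem sum_eq_sum_inter_add_sum_compl_inter {M : Type*} [AddCommMonoid M] (s z : Finset α)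
    (f : α → M) : ∑ j ∈ z, f j = ∑ j ∈ s ∩ z, f j + ∑ j ∈ sᶜ ∩ z, f j := by
  rw [← Finset.sum_inter_add_sum_sdiff z s, Finset.inter_comm, Finset.inter_comm sᶜ,
    Finset.sdiff_eq_inter_compl]

theorem card_inter_add_card_compl_inter (s z : Finset α) :
    (s ∩ z).card + (sᶜ ∩ z).card = z.card := by
  simpa only [Finset.card_eq_sum_ones] using
    (sum_eq_sum_inter_add_sum_compl_inter s z fun _ => 1).symm

/-- A function on finsets that is harmonic of degree `a` on `s` and of degree `b` on the complement
of `s`. -/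
structure IsBiharmonic (s : Finset α) (a b : ℕ) (φ : Finset α → R) : Prop where
  inside : IsHarmonic s a φ
  outside : IsHarmonic sᶜ b φ

theorem exists_isBiharmonic [IsDomain R] (ha : 2 * a ≤ s.card) (hb : 2 * b ≤ sᶜ.card) :
    ∃ φ : Finset α → R, IsBiharmonic s a b φ ∧ ∃ z, φ z ≠ 0 := by
  obtain ⟨φ, hφ, hφs, u, hu⟩ := exists_isHarmonic (R := R) ha
  obtain ⟨ψ, hψ, hψs, v, hv⟩ := exists_isHarmonic (R := R) hb
  have hφ_inv : IsInvariant sᶜ φ := isInvariant_of_inter_eq disjoint_compl_right hφs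
  have hψ_inv : IsInvariant s ψ := isInvariant_of_inter_eq disjoint_compl_left hψs
  have hs : s ∩ (s ∩ u ∪ sᶜ ∩ v) = s ∩ u := by
    rw [Finset.inter_union_distrib_left, ← Finset.inter_assoc, ← Finset.inter_assoc,
      Finset.inter_self, Finset.inter_compl, Finset.empty_inter, Finset.union_empty]
  have hsc : sᶜ ∩ (s ∩ u ∪ sᶜ ∩ v) = sᶜ ∩ v := by
    rw [Finset.inter_union_distrib_left, ← Finset.inter_assoc, ← Finset.inter_assoc,
      Finset.inter_self, Finset.inter_comm sᶜ s, Finset.inter_compl, Finset.empty_inter,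
      Finset.empty_union]
  refine ⟨fun z => φ z * ψ z,
    ⟨by simpa only [mul_comm] using hφ.invariant_mul hψ_inv, hψ.invariant_mul hφ_inv⟩,
    s ∩ u ∪ sᶜ ∩ v, ?_⟩
  change φ _ * ψ _ ≠ 0
  rw [← hφs, hs, hφs, ← hψs, hsc, hψs]
  exact mul_ne_zero hu hv

namespace IsBiharmonic

theorem isHarmonic (h : IsBiharmonic s a b φ) : IsHarmonic Finset.univ (a + b) φ := by
  simpa only [Finset.union_compl] using h.inside.union h.outside disjoint_compl_right

theorem exists_card_inter_eq [NoZeroDivisors R] [CharZero R] (h : IsBiharmonic s a b φ)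
    {z : Finset α} (hz : φ z ≠ 0) {p q : ℕ} (hap : a ≤ p) (hp : p + a ≤ s.card) (hbq : b ≤ q)
    (hq : q + b ≤ sᶜ.card) : ∃ w, φ w ≠ 0 ∧ (s ∩ w).card = p ∧ (sᶜ ∩ w).card = q := by
  obtain ⟨v, hv, -, hvp⟩ := h.inside.exists_card_inter_eq hz hap hp
  obtain ⟨w, hw, hwv, hwq⟩ := h.outside.exists_card_inter_eq hv hbq hq
  have hsw : s ∩ w = s ∩ v := by
    simpa only [sdiff_compl, Finset.inf_eq_inter, Finset.inter_comm s] using hwv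
  exact ⟨w, hw, by rw [hsw, hvp], hwq⟩

theorem booleanDown_mul (h : IsBiharmonic s a b φ) (r : ℕ → ℕ → R) (z : Finset α) :
    booleanDown (fun w => r (s ∩ w).card (sᶜ ∩ w).card * φ w) z
      = (r ((s ∩ z).card + 1) (sᶜ ∩ z).card * (s.card - (s ∩ z).card - a)
          + r (s ∩ z).card ((sᶜ ∩ z).card + 1) * (sᶜ.card - (sᶜ ∩ z).card - b)) * φ z := by
  have hin : ∀ k ∈ s \ z, r (s ∩ insert k z).card (sᶜ ∩ insert k z).card * φ (insert k z)
      = r ((s ∩ z).card + 1) (sᶜ ∩ z).card * φ (insert k z) := fun k hk => by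
    obtain ⟨hks, hkz⟩ := Finset.mem_sdiff.1 hk
    rw [Finset.inter_insert_of_mem hks, Finset.inter_insert_of_notMem (by simpa using hks),
      Finset.card_insert_of_notMem fun h => hkz (Finset.mem_inter.1 h).2]
  have hout : ∀ k ∈ sᶜ \ z, r (s ∩ insert k z).card (sᶜ ∩ insert k z).card * φ (insert k z)
      = r (s ∩ z).card ((sᶜ ∩ z).card + 1) * φ (insert k z) := fun k hk => by
    obtain ⟨hks, hkz⟩ := Finset.mem_sdiff.1 hk
    rw [Finset.inter_insert_of_mem hks, Finset.inter_insert_of_notMem (Finset.mem_compl.1 hks),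
      Finset.card_insert_of_notMem fun h => hkz (Finset.mem_inter.1 h).2]
  have hcard (u : Finset α) : ((u \ z).card : R) = u.card - (u ∩ z).card := by
    rw [← Finset.card_sdiff_add_card_inter u z, Nat.cast_add, add_sub_cancel_right]
  rw [booleanDown, sum_eq_sum_inter_add_sum_compl_inter s, ← Finset.sdiff_eq_inter_compl,
    ← Finset.sdiff_eq_inter_compl, Finset.sum_congr rfl hin, Finset.sum_congr rfl hout,
    ← Finset.mul_sum, ← Finset.mul_sum, h.inside.sum_insert, h.outside.sum_insert,
    hcard s, hcard sᶜ]
  ring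

theorem exchange_mul (h : IsBiharmonic s a b φ) (r : ℤ → R) (z : Finset α) :
    exchange (fun w => r (sᶜ ∩ w).card * φ w) z
      = (r (sᶜ ∩ z).card * (((s \ z).card + 1 - a) * ((s ∩ z).card - a) - (s ∩ z).card
            + (((sᶜ \ z).card + 1 - b) * ((sᶜ ∩ z).card - b) - (sᶜ ∩ z).card))
          + r ((sᶜ ∩ z).card + 1) * (((sᶜ \ z).card - b) * ((s ∩ z).card - a))
          + r ((sᶜ ∩ z).card - 1) * (((s \ z).card - a) * ((sᶜ ∩ z).card - b))) * φ z := by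
  have hsplit : ∀ u v : Finset α, ∀ d : ℤ,
      (∀ j ∈ u, ∀ k ∈ v, (if k ∈ sᶜ then 1 else 0) = (if j ∈ sᶜ then 1 else 0) + d) →
      ∑ j ∈ u ∩ z, ∑ k ∈ v \ z, r (sᶜ ∩ insert k (z.erase j)).card * φ (insert k (z.erase j))
        = r ((sᶜ ∩ z).card + d) * ∑ j ∈ u ∩ z, ∑ k ∈ v \ z, φ (insert k (z.erase j)) := by
    intro u v d hd
    simp only [Finset.mul_sum]
    refine Finset.sum_congr rfl fun j hj => Finset.sum_congr rfl fun k hk => ?_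
    obtain ⟨hju, hjz⟩ := Finset.mem_inter.1 hj
    obtain ⟨hkv, hkz⟩ := Finset.mem_sdiff.1 hk
    have hcard := card_inter_insert_erase sᶜ hjz hkz
    have hd := hd j hju k hkv
    congr 2
    push_cast [← @Nat.cast_inj ℤ] at hcard
    linear_combination hcard + hd
  have hs : ∀ j ∈ s, (if j ∈ sᶜ then 1 else 0 : ℤ) = 0 := fun j hj => if_neg (by simpa using hj)
  have hs' : ∀ j ∈ sᶜ, (if j ∈ sᶜ then 1 else 0 : ℤ) = 1 := fun j hj => if_pos hj
  simp only [exchange, sum_eq_sum_inter_add_sum_compl_inter s z,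
    sum_eq_sum_inter_add_sum_compl_inter s zᶜ, ← Finset.sdiff_eq_inter_compl,
    Finset.sum_add_distrib]
  rw [hsplit s s 0 fun j hj k hk => by rw [hs j hj, hs k hk, add_zero],
    hsplit s sᶜ 1 fun j hj k hk => by rw [hs j hj, hs' k hk, zero_add],
    hsplit sᶜ s (-1) fun j hj k hk => by rw [hs' j hj, hs k hk, add_neg_cancel],
    hsplit sᶜ sᶜ 0 fun j hj k hk => by rw [hs' j hj, hs' k hk, add_zero],
    h.inside.sum_swap_self, h.outside.sum_swap_self,
    h.inside.sum_swap h.outside disjoint_compl_right,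
    h.outside.sum_swap h.inside disjoint_compl_left, add_zero, ← sub_eq_add_neg]
  ring

end IsBiharmonic

theorem IsHarmonic.exchange_eq (h : IsHarmonic Finset.univ a φ) (z : Finset α) :
    exchange φ z = ((Fintype.card α - z.card + 1 - a) * (z.card - a) - z.card) * φ z := by
  have := h.sum_swap_self z
  rwa [Finset.univ_inter, ← Finset.compl_eq_univ_sdiff, Finset.card_compl,
    Nat.cast_sub (Finset.card_le_univ z)] at this

end BooleanLattice

/-! ### Johnson graphs -/

section Johnson

variable {n D : ℕ}

/-- Replace the element `j` of `y` by the element `k` outside `y`. -/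
def swap (y : JohnsonVertex n D) {j k : Fin n} (hj : j ∈ y.1) (hk : k ∉ y.1) :
    JohnsonVertex n D :=
  ⟨insert k (y.1.erase j), by
    rw [Finset.card_insert_of_notMem fun h => hk (Finset.mem_of_mem_erase h),
      Finset.card_erase_add_one hj, y.2]⟩

theorem sdiff_swap (y : JohnsonVertex n D) {j k : Fin n} (hj : j ∈ y.1) (hk : k ∉ y.1) :
    y.1 \ (swap y hj hk).1 = {j} := by
  rw [swap, Finset.sdiff_insert_of_notMem hk, Finset.sdiff_erase hj, Finset.sdiff_self,
    insert_empty_eq]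

theorem swap_sdiff (y : JohnsonVertex n D) {j k : Fin n} (hj : j ∈ y.1) (hk : k ∉ y.1) :
    (swap y hj hk).1 \ y.1 = {k} := by
  rw [swap, Finset.insert_sdiff_of_notMem _ hk,
    Finset.sdiff_eq_empty_iff_subset.2 (Finset.erase_subset _ _), insert_empty_eq]

theorem johnson_adj_iff {y z : JohnsonVertex n D} :
    (johnson n D).Adj y z ↔ ∃ (j k : Fin n) (hj : j ∈ y.1) (hk : k ∉ y.1), swap y hj hk = z := by
  have hy := Finset.card_sdiff_add_card_inter y.1 z.1
  rw [y.2] at hy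
  constructor
  · intro (h : (y.1 ∩ z.1).card + 1 = D)
    have hz := Finset.card_sdiff_add_card_inter z.1 y.1
    rw [z.2, Finset.inter_comm] at hz
    obtain ⟨j, hj⟩ := Finset.card_eq_one.1 (by lia : (y.1 \ z.1).card = 1)
    obtain ⟨k, hk⟩ := Finset.card_eq_one.1 (by lia : (z.1 \ y.1).card = 1)
    obtain ⟨hjy, -⟩ := Finset.mem_sdiff.1 (hj ▸ Finset.mem_singleton_self j)
    obtain ⟨-, hky⟩ := Finset.mem_sdiff.1 (hk ▸ Finset.mem_singleton_self k)
    refine ⟨j, k, hjy, hky, Subtype.ext ?_⟩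
    change insert k (y.1.erase j) = z.1
    rw [Finset.erase_eq, ← hj, sdiff_sdiff_right_self, Finset.insert_eq, ← hk, Finset.inf_eq_inter,
      Finset.inter_comm, Finset.sdiff_union_inter]
  · rintro ⟨j, k, hj, hk, rfl⟩
    rw [sdiff_swap, Finset.card_singleton] at hy
    change _ + 1 = D
    lia

theorem card_sdiff_eq_card_compl_inter (x y : JohnsonVertex n D) :
    (x.1 \ y.1).card = (x.1ᶜ ∩ y.1).card := by
  rw [Finset.inter_comm, ← Finset.sdiff_eq_inter_compl]
  exact Finset.card_sdiff_comm (x.2.trans y.2.symm)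

theorem exists_adj_card_compl_inter_add_one (x y : JohnsonVertex n D) (h : (x.1ᶜ ∩ y.1).card ≠ 0) :
    ∃ z, (johnson n D).Adj y z ∧ (x.1ᶜ ∩ z.1).card + 1 = (x.1ᶜ ∩ y.1).card := by
  obtain ⟨j, hj⟩ := Finset.card_ne_zero.1 h
  obtain ⟨k, hk⟩ := Finset.card_ne_zero.1 (card_sdiff_eq_card_compl_inter x y ▸ h)
  obtain ⟨hjx, hjy⟩ := Finset.mem_inter.1 hj
  obtain ⟨hkx, hky⟩ := Finset.mem_sdiff.1 hk
  refine ⟨swap y hjy hky, johnson_adj_iff.2 ⟨j, k, hjy, hky, rfl⟩, ?_⟩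
  have hswap := card_inter_insert_erase x.1ᶜ hjy hky
  rwa [if_pos hjx, if_neg (Finset.notMem_compl.2 hkx)] at hswap

theorem johnson_dist (x y : JohnsonVertex n D) :
    (johnson n D).dist x y = (x.1ᶜ ∩ y.1).card := by
  refine dist_eq_of_level (fun y => (x.1ᶜ ∩ y.1).card) (fun y => ?_) (fun y z h => ?_)
    (exists_adj_card_compl_inter_add_one x) y
  · rw [Finset.card_eq_zero, Finset.inter_comm, ← Finset.sdiff_eq_inter_compl,
      Finset.sdiff_eq_empty_iff_subset]
    exact ⟨fun h => Subtype.ext (Finset.eq_of_subset_of_card_le h (x.2.trans y.2.symm).le),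
      fun h => h ▸ subset_rfl⟩
  · obtain ⟨j, k, hj, hk, rfl⟩ := johnson_adj_iff.1 h
    have hswap := card_inter_insert_erase x.1ᶜ hj hk
    change (x.1ᶜ ∩ insert k (y.1.erase j)).card ≤ _
    split_ifs at hswap <;> lia

theorem johnson_dist_eq_one_iff {x y : JohnsonVertex n D} :
    (johnson n D).dist x y = 1 ↔ ∃ (j k : Fin n) (hj : j ∈ x.1) (hk : k ∉ x.1), swap x hj hk = y :=
  SimpleGraph.dist_eq_one_iff_adj.trans johnson_adj_iff

theorem le_of_johnsonVertex (x : JohnsonVertex n D) : D ≤ n :=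
  x.2 ▸ (Finset.card_le_univ x.1).trans_eq (Fintype.card_fin n)

theorem card_compl_johnsonVertex (x : JohnsonVertex n D) : x.1ᶜ.card = n - D := by
  rw [Finset.card_compl, x.2, Fintype.card_fin]

/-- Restriction of a function on the Boolean lattice to the vertices of the Johnson graph. -/
def restrict (n D : ℕ) (f : Finset (Fin n) → ℂ) : JohnsonVertex n D → ℂ := fun y => f y.1

theorem exists_restrict_eq (v : JohnsonVertex n D → ℂ) :
    ∃ f, (∀ z, f z ≠ 0 → z.card = D) ∧ restrict n D f = v :=
  ⟨fun z => if h : z.card = D then v ⟨z, h⟩ else 0, fun _ hz => not_not.1 fun h => hz (dif_neg h),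
    funext fun y => dif_pos y.2⟩

theorem adjacency_mulVec_restrict (f : Finset (Fin n) → ℂ) :
    adjacency (johnson n D) *ᵥ restrict n D f = restrict n D (exchange f) := by
  classical
  ext y
  rw [adjacency, SimpleGraph.adjMatrix_mulVec_apply, restrict, exchange, ← Finset.sum_product']
  symm
  refine Finset.sum_bij
    (fun p hp => swap y (Finset.mem_product.1 hp).1
      (Finset.mem_compl.1 (Finset.mem_product.1 hp).2))
    (fun p hp => ?_) (fun p hp q hq hpq => ?_) (fun z hz => ?_) (fun _ _ => rfl)
  · rw [SimpleGraph.mem_neighborFinset, johnson_adj_iff]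
    exact ⟨_, _, _, _, rfl⟩
  · have hfst := congrArg (y.1 \ ·.1) hpq
    have hsnd := congrArg (·.1 \ y.1) hpq
    simp only [sdiff_swap, swap_sdiff] at hfst hsnd
    exact Prod.ext (Finset.singleton_injective hfst) (Finset.singleton_injective hsnd)
  · rw [SimpleGraph.mem_neighborFinset, johnson_adj_iff] at hz
    obtain ⟨j, k, hj, hk, rfl⟩ := hz
    exact ⟨(j, k), Finset.mem_product.2 ⟨hj, Finset.mem_compl.2 hk⟩, rfl⟩

theorem dualIdempotent_mulVec_restrict (x : JohnsonVertex n D) (i : ℕ) (f : Finset (Fin n) → ℂ) :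
    dualIdempotent (johnson n D) x i *ᵥ restrict n D f
      = restrict n D fun z => (if ((x.1ᶜ ∩ z).card : ℤ) = i then 1 else 0) * f z := by
  ext y
  rw [dualIdempotent_mulVec_apply, johnson_dist]
  simp only [restrict, Nat.cast_inj, ite_mul, one_mul, zero_mul]

theorem dualIdempotent_mulVec_restrict_ne_zero_iff {x : JohnsonVertex n D} {i : ℕ}
    {f : Finset (Fin n) → ℂ} :
    dualIdempotent (johnson n D) x i *ᵥ restrict n D f ≠ 0
      ↔ ∃ z : Finset (Fin n), z.card = D ∧ (x.1ᶜ ∩ z).card = i ∧ f z ≠ 0 := by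
  simp only [dualIdempotent_mulVec_ne_zero_iff, johnson_dist, Subtype.exists, restrict, exists_prop]

/-- The ladder coefficients of functions that are harmonic of degree `a` on the base vertex and of
degree `b` on its complement. -/
def johnsonCoeff (n D a b i j : ℕ) : ℂ :=
  if j = i then (i + 1 - a) * (D - i - a) - (D - i) + ((n - D - i + 1 - b) * (i - b) - i)
  else if j = i + 1 then (n - D - i - b) * (D - i - a)
  else if i = j + 1 then (i - a) * (i - b)
  else 0

theorem IsBiharmonic.isLadder {x : JohnsonVertex n D} {a b : ℕ} {φ : Finset (Fin n) → ℂ}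
    (h : IsBiharmonic x.1 a b φ) :
    IsLadder (johnson n D) x (restrict n D φ) (johnsonCoeff n D a b) := by
  intro j
  ext y
  rw [dualIdempotent_mulVec_restrict, adjacency_mulVec_restrict, radialMul_apply, johnson_dist,
    restrict, h.exchange_mul fun l => if l = j then 1 else 0]
  have hinter : ((x.1 ∩ y.1).card : ℂ) = D - (x.1ᶜ ∩ y.1).card := by
    have hy := y.2
    rw [← card_inter_add_card_compl_inter x.1] at hy
    exact eq_sub_of_add_eq (by exact_mod_cast hy)
  have hin : ((x.1 \ y.1).card : ℂ) = (x.1ᶜ ∩ y.1).card := by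
    rw [card_sdiff_eq_card_compl_inter]
  have hout : ((x.1ᶜ \ y.1).card : ℂ) = n - D - (x.1ᶜ ∩ y.1).card := by
    rw [← Nat.cast_sub (le_of_johnsonVertex x), ← card_compl_johnsonVertex x,
      ← Finset.card_sdiff_add_card_inter x.1ᶜ y.1, Nat.cast_add, add_sub_cancel_right]
  rw [hinter, hin, hout, johnsonCoeff]
  generalize (x.1ᶜ ∩ y.1).card = i
  congr 1
  split_ifs <;> first | lia | ring

theorem johnsonCoeff_self_succ (n D a b i : ℕ) :
    johnsonCoeff n D a b i (i + 1) = (n - D - i - b) * (D - i - a) := by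
  rw [johnsonCoeff, if_neg i.succ_ne_self, if_pos rfl]

theorem johnsonCoeff_succ_self (n D a b i : ℕ) :
    johnsonCoeff n D a b (i + 1) i = (i + 1 - a) * (i + 1 - b) := by
  rw [johnsonCoeff, if_neg i.succ_ne_self.symm, if_neg (by lia), if_pos rfl, Nat.cast_succ]

theorem johnsonCoeff_self_succ_ne_zero {n D a b i : ℕ} (ha : i + a < D) (hb : D + i + b < n) :
    johnsonCoeff n D a b i (i + 1) ≠ 0 := by
  rw [johnsonCoeff_self_succ, sub_sub, sub_sub, sub_sub, ← add_assoc]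
  exact mul_ne_zero (sub_ne_zero.2 (by exact_mod_cast hb.ne'))
    (sub_ne_zero.2 (by exact_mod_cast ha.ne'))

theorem johnsonCoeff_succ_self_ne_zero {a b i : ℕ} (n D : ℕ) (ha : a ≤ i) (hb : b ≤ i) :
    johnsonCoeff n D a b (i + 1) i ≠ 0 := by
  rw [johnsonCoeff_succ_self]
  exact mul_ne_zero (sub_ne_zero.2 (by exact_mod_cast (Nat.lt_succ_of_le ha).ne'))
    (sub_ne_zero.2 (by exact_mod_cast (Nat.lt_succ_of_le hb).ne'))

end Johnson

/-! ### The spectrum of a Johnson graph -/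

section JohnsonSpectrum

variable {n D j : ℕ}

/-- The eigenvalue of `J(n, D)` on harmonic functions of degree `j`. -/
def johnsonEigenvalue (n D j : ℕ) : ℝ := (D - j) * (n - D - j) - j

theorem johnsonEigenvalue_strictAntiOn (hn : 2 * D ≤ n) :
    StrictAntiOn (johnsonEigenvalue n D) (Set.Iic D) := by
  intro j _ k (hk : k ≤ D) hjk
  have hpos : (0 : ℝ) < (k - j) * (n - j - k + 1) :=
    mul_pos (sub_pos.2 (by exact_mod_cast hjk))
      (by rw [sub_sub, sub_add_eq_add_sub, sub_pos]; exact_mod_cast (by lia))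
  rw [johnsonEigenvalue, johnsonEigenvalue]
  linear_combination hpos

theorem IsHarmonic.adjacency_mulVec_restrict {φ : Finset (Fin n) → ℂ}
    (h : IsHarmonic Finset.univ j φ) :
    adjacency (johnson n D) *ᵥ restrict n D φ
      = (johnsonEigenvalue n D j : ℂ) • restrict n D φ := by
  ext y
  rw [UniformStructure.adjacency_mulVec_restrict, restrict, h.exchange_eq, y.2, Fintype.card_fin,
    Pi.smul_apply, smul_eq_mul, restrict, johnsonEigenvalue]
  push_cast
  ring

theorem johnsonEigenvalue_mem_eigenvalues (hn : 2 * D ≤ n) (hj : j ≤ D) :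
    johnsonEigenvalue n D j ∈ eigenvalues (johnson n D) := by
  obtain ⟨φ, hφ, -, z, hz⟩ := exists_isHarmonic (R := ℂ) (s := (Finset.univ : Finset (Fin n)))
    (a := j) (by rw [Finset.card_univ, Fintype.card_fin]; lia)
  obtain ⟨w, hw, -, hwD⟩ := hφ.exists_card_inter_eq hz hj
    (by rw [Finset.card_univ, Fintype.card_fin]; lia)
  rw [Finset.univ_inter] at hwD
  exact mem_eigenvalues_iff.2
    ⟨_, Function.ne_iff.2 ⟨⟨w, hwD⟩, hw⟩, hφ.adjacency_mulVec_restrict⟩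

theorem exists_johnsonEigenvalue_eq {S : Set (Finset (Fin n) → ℂ)}
    (hS : ∀ f ∈ S, booleanDown f ∈ S) {f : Finset (Fin n) → ℂ} (hfS : f ∈ S)
    (hfD : ∀ z, f z ≠ 0 → z.card = D) (hf : f ≠ 0) {θ : ℝ}
    (hθ : adjacency (johnson n D) *ᵥ restrict n D f = (θ : ℂ) • restrict n D f) :
    ∃ j ≤ D, θ = johnsonEigenvalue n D j ∧ ∃ g ∈ S, ∃ z, z.card = j ∧ g z ≠ 0 := by
  have hμ : booleanUp (booleanDown f) = (D + θ : ℂ) • f := by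
    ext z
    rw [booleanUp_booleanDown, Pi.smul_apply, smul_eq_mul]
    by_cases hz : z.card = D
    · have hθz : exchange f z = θ * f z := by
        rw [adjacency_mulVec_restrict] at hθ
        exact congrFun hθ ⟨z, hz⟩
      rw [hz, hθz]
      ring
    · have hfz : f z = 0 := not_not.1 (mt (hfD z) hz)
      rw [hfz, mul_zero, mul_zero, zero_add, exchange]
      refine Finset.sum_eq_zero fun j hj => Finset.sum_eq_zero fun k hk => ?_
      refine not_not.1 (mt (hfD _) ?_)
      rwa [Finset.card_insert_of_notMem
        fun h => Finset.mem_compl.1 hk (Finset.mem_of_mem_erase h), Finset.card_erase_add_one hj]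
  obtain ⟨j, hj, hμj, hg⟩ := exists_level_of_booleanUp_booleanDown_eq hS hfS hf hfD hμ
  refine ⟨j, hj, ?_, hg⟩
  rw [Fintype.card_fin] at hμj
  have hμj' : D + θ = (D - j) * (n - j - D + 1) := by exact_mod_cast hμj
  rw [johnsonEigenvalue]
  linear_combination hμj'

theorem eigenvalues_johnson (hn : 2 * D ≤ n) :
    eigenvalues (johnson n D) = (Finset.range (D + 1)).image (johnsonEigenvalue n D) := by
  ext θ
  simp only [Finset.mem_image, Finset.mem_range, Nat.lt_succ_iff]
  constructor
  · intro h
    obtain ⟨v, hv, hθ⟩ := mem_eigenvalues_iff.1 h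
    obtain ⟨f, hfD, rfl⟩ := exists_restrict_eq v
    obtain ⟨j, hj, hθj, -⟩ := exists_johnsonEigenvalue_eq (S := Set.univ)
      (fun _ _ => Set.mem_univ _) (Set.mem_univ f) hfD (fun h => hv (by rw [h]; rfl)) hθ
    exact ⟨j, hj, hθj.symm⟩
  · rintro ⟨j, hj, rfl⟩
    exact johnsonEigenvalue_mem_eigenvalues hn hj

theorem eigenvalueIndex_johnsonEigenvalue (hn : 2 * D ≤ n) (hj : j ≤ D) :
    eigenvalueIndex (johnson n D) (johnsonEigenvalue n D j) = j := by
  have hanti := johnsonEigenvalue_strictAntiOn hn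
  have hfilter : (eigenvalues (johnson n D)).filter (johnsonEigenvalue n D j < ·)
      = (Finset.range j).image (johnsonEigenvalue n D) := by
    rw [eigenvalues_johnson hn, Finset.filter_image]
    congr 1
    ext k
    simp only [Finset.mem_filter, Finset.mem_range, Nat.lt_succ_iff]
    exact ⟨fun ⟨hk, h⟩ => (hanti.lt_iff_gt hj hk).1 h,
      fun h => ⟨h.le.trans hj, hanti (h.le.trans hj) hj h⟩⟩
  rw [eigenvalueIndex, hfilter, Finset.card_image_of_injOn, Finset.card_range]
  exact hanti.injOn.mono fun k hk => (Finset.mem_range.1 hk).le.trans hj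

end JohnsonSpectrum

/-! ### Modules of biharmonic functions -/

section BiharmonicModule

variable {n D a b : ℕ} {x : JohnsonVertex n D} {φ φ' : Finset (Fin n) → ℂ}

theorem exists_restrict_ne_zero (x : JohnsonVertex n D) (ha : 2 * a ≤ D)
    (hb : 2 * b ≤ n - D) (hab : a + b ≤ D) (hab' : a + b ≤ n - D) :
    ∃ φ : Finset (Fin n) → ℂ, IsBiharmonic x.1 a b φ ∧ restrict n D φ ≠ 0 := by
  have hx := card_compl_johnsonVertex x
  obtain ⟨φ, hφ, z, hz⟩ := exists_isBiharmonic (R := ℂ) (s := x.1) (a := a) (b := b)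
    (by rwa [x.2]) (by rwa [hx])
  obtain ⟨w, hw, hwp, hwq⟩ := hφ.exists_card_inter_eq hz (p := D - max a b) (q := max a b)
    (by lia) (by have := x.2; lia) (by lia) (by lia)
  have hwD : w.card = D := by
    rw [← card_inter_add_card_compl_inter x.1, hwp, hwq]
    lia
  exact ⟨φ, hφ, Function.ne_iff.2 ⟨⟨w, hwD⟩, hw⟩⟩

/-- The subspace of all products of `φ` with a function of the distance to `x`; it is an
irreducible module of the Terwilliger algebra of `J(n, D)` when `φ` is biharmonic. -/
abbrev harmonicModule (x : JohnsonVertex n D) (φ : Finset (Fin n) → ℂ) :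
    Submodule ℂ (JohnsonVertex n D → ℂ) :=
  radialSpan (johnson n D) x (restrict n D φ)

namespace IsBiharmonic

theorem dualIdempotent_mulVec_restrict_ne_zero_iff (h : IsBiharmonic x.1 a b φ)
    (hφ : restrict n D φ ≠ 0) {i : ℕ} :
    dualIdempotent (johnson n D) x i *ᵥ restrict n D φ ≠ 0
      ↔ i ∈ Set.Icc (max a b) (min (D - a) (n - D - b)) := by
  have hx := x.2
  have hx' := card_compl_johnsonVertex x
  obtain ⟨y, hy : φ y.1 ≠ 0⟩ := Function.ne_iff.1 hφ
  have bounds {z : Finset (Fin n)} (hz : φ z ≠ 0) :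
      a + (x.1 ∩ z).card ≤ D ∧ a ≤ (x.1 ∩ z).card ∧
        b + (x.1ᶜ ∩ z).card ≤ n - D ∧ b ≤ (x.1ᶜ ∩ z).card := by
    have := Finset.card_sdiff_add_card_inter x.1 z
    have := Finset.card_sdiff_add_card_inter x.1ᶜ z
    exact ⟨by grind [h.inside.le_card_sdiff hz], h.inside.le_card_inter hz,
      by grind [h.outside.le_card_sdiff hz], h.outside.le_card_inter hz⟩
  rw [UniformStructure.dualIdempotent_mulVec_restrict_ne_zero_iff, Set.mem_Icc]
  constructor
  · rintro ⟨z, hzD, hzi, hz⟩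
    have := bounds hz
    have := card_inter_add_card_compl_inter x.1 z
    lia
  · intro hi
    have := bounds hy
    obtain ⟨z, hz, hzp, hzi⟩ := h.exists_card_inter_eq hy (p := D - i) (q := i)
      (by lia) (by lia) (by lia) (by lia)
    refine ⟨z, ?_, hzi, hz⟩
    rw [← card_inter_add_card_compl_inter x.1, hzp, hzi]
    lia

theorem max_le_min (h : IsBiharmonic x.1 a b φ) (hφ : restrict n D φ ≠ 0) :
    max a b ≤ min (D - a) (n - D - b) := by
  obtain ⟨y, hy : φ y.1 ≠ 0⟩ := Function.ne_iff.1 hφ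
  exact Set.nonempty_Icc.1 ⟨_, (h.dualIdempotent_mulVec_restrict_ne_zero_iff hφ).1
    (UniformStructure.dualIdempotent_mulVec_restrict_ne_zero_iff.2 ⟨y.1, y.2, rfl, hy⟩)⟩

theorem dualSupport_harmonicModule (h : IsBiharmonic x.1 a b φ) (hφ : restrict n D φ ≠ 0) :
    dualSupport (johnson n D) x (harmonicModule x φ)
      = Set.Icc (max a b) (min (D - a) (n - D - b)) := by
  rw [dualSupport_radialSpan]
  ext i
  exact h.dualIdempotent_mulVec_restrict_ne_zero_iff hφ

theorem endpoint_harmonicModule (h : IsBiharmonic x.1 a b φ) (hφ : restrict n D φ ≠ 0) :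
    endpoint (johnson n D) x (harmonicModule x φ) = max a b := by
  rw [endpoint, h.dualSupport_harmonicModule hφ, csInf_Icc (h.max_le_min hφ)]

theorem moduleDiameter_harmonicModule (h : IsBiharmonic x.1 a b φ) (hφ : restrict n D φ ≠ 0) :
    moduleDiameter (johnson n D) x (harmonicModule x φ)
      = min (D - a) (n - D - b) - max a b := by
  have := h.max_le_min hφ
  rw [moduleDiameter, h.dualSupport_harmonicModule hφ, ← Finset.coe_Icc, Set.ncard_coe_finset,
    Nat.card_Icc]
  lia

theorem harmonicModule_le (h : IsBiharmonic x.1 a b φ)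
    {U : Submodule ℂ (JohnsonVertex n D → ℂ)} (hU : IsTModule (johnson n D) x U) {i : ℕ}
    (hi : dualIdempotent (johnson n D) x i *ᵥ restrict n D φ ≠ 0)
    (hiU : dualIdempotent (johnson n D) x i *ᵥ restrict n D φ ∈ U) :
    harmonicModule x φ ≤ U := by
  have hφ : restrict n D φ ≠ 0 := fun h0 => hi (by rw [h0, mulVec_zero])
  exact h.isLadder.radialSpan_le_of_mem hU
    (fun _ => h.dualIdempotent_mulVec_restrict_ne_zero_iff hφ)
    (fun _ hi _ => johnsonCoeff_succ_self_ne_zero n D (by lia) (by lia))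
    (fun _ _ hi => johnsonCoeff_self_succ_ne_zero (by lia) (by lia))
    ((h.dualIdempotent_mulVec_restrict_ne_zero_iff hφ).1 hi) hiU

theorem isIrreducibleTModule_harmonicModule (h : IsBiharmonic x.1 a b φ)
    (hφ : restrict n D φ ≠ 0) :
    IsIrreducibleTModule (johnson n D) x (harmonicModule x φ) :=
  h.isLadder.isIrreducibleTModule (h.max_le_min hφ)
    (fun _ => h.dualIdempotent_mulVec_restrict_ne_zero_iff hφ)
    (fun _ hi _ => johnsonCoeff_succ_self_ne_zero n D (by lia) (by lia))
    (fun _ _ hi => johnsonCoeff_self_succ_ne_zero (by lia) (by lia))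

theorem isTIsomorphic_harmonicModule (h : IsBiharmonic x.1 a b φ) (h' : IsBiharmonic x.1 a b φ')
    (hφ : restrict n D φ ≠ 0) (hφ' : restrict n D φ' ≠ 0) :
    IsTIsomorphic (johnson n D) x (harmonicModule x φ) (harmonicModule x φ') :=
  h.isLadder.isTIsomorphic h'.isLadder fun _ =>
    (h.dualIdempotent_mulVec_restrict_ne_zero_iff hφ).trans
      (h'.dualIdempotent_mulVec_restrict_ne_zero_iff hφ').symm

-- The products of `φ` with functions of `|x ∩ z|` and `|xᶜ ∩ z|` are stable under `booleanDown`,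
-- and they vanish on the sets with fewer than `a + b` elements.
theorem exists_johnsonEigenvalue_eq (h : IsBiharmonic x.1 a b φ) {w : JohnsonVertex n D → ℂ}
    (hw : w ∈ harmonicModule x φ) (hw0 : w ≠ 0) {θ : ℝ}
    (hθ : adjacency (johnson n D) *ᵥ w = (θ : ℂ) • w) :
    ∃ j, a + b ≤ j ∧ j ≤ D ∧ θ = johnsonEigenvalue n D j := by
  obtain ⟨t, rfl⟩ := hw
  let mul (r : ℕ → ℕ → ℂ) (z : Finset (Fin n)) : ℂ := r (x.1 ∩ z).card (x.1ᶜ ∩ z).card * φ z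
  let r (p q : ℕ) : ℂ := if p + q = D then t q else 0
  have hr : restrict n D (mul r) = radialMul (johnson n D) x (restrict n D φ) t := by
    ext y
    rw [radialMul_apply, johnson_dist]
    simp only [restrict, mul, r, card_inter_add_card_compl_inter, y.2, if_true]
  rw [← hr] at hw0 hθ
  have hdown : ∀ f ∈ Set.range mul, booleanDown f ∈ Set.range mul := by
    rintro _ ⟨r, rfl⟩
    exact ⟨fun p q => r (p + 1) q * (x.1.card - p - a) + r p (q + 1) * (x.1ᶜ.card - q - b),
      funext fun z => (h.booleanDown_mul r z).symm⟩
  have hlevel : ∀ z, mul r z ≠ 0 → z.card = D := fun z hz => by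
    rw [← card_inter_add_card_compl_inter x.1]
    by_contra hne
    exact hz (by simp only [mul, r, if_neg hne, zero_mul])
  obtain ⟨j, hj, hθj, _, ⟨r, rfl⟩, z, rfl, hz⟩ := UniformStructure.exists_johnsonEigenvalue_eq hdown
    ⟨r, rfl⟩ hlevel (fun h0 => hw0 (by rw [h0]; rfl)) hθ
  refine ⟨z.card, ?_, hj, hθj⟩
  simpa only [Finset.univ_inter] using h.isHarmonic.le_card_inter (right_ne_zero_of_mul hz)

theorem dualEndpoint_harmonicModule (h : IsBiharmonic x.1 a b φ) (hφ : restrict n D φ ≠ 0)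
    (hn : 2 * D ≤ n) (hab : a + b ≤ D) :
    dualEndpoint (johnson n D) (harmonicModule x φ) = a + b := by
  rw [dualEndpoint_eq h.isLadder.isTModule (self_mem_radialSpan _) hφ
    h.isHarmonic.adjacency_mulVec_restrict, eigenvalueIndex_johnsonEigenvalue hn hab]
  intro w hw hw0 θ hθ
  obtain ⟨j, habj, hjD, rfl⟩ := h.exists_johnsonEigenvalue_eq hw hw0 hθ
  rwa [eigenvalueIndex_johnsonEigenvalue hn hab, eigenvalueIndex_johnsonEigenvalue hn hjD]

end IsBiharmonic

end BiharmonicModule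

/-! ### Uniform structures on Johnson graphs -/

section JohnsonUniform

variable {n D : ℕ} {x : JohnsonVertex n D} {U : Matrix ℕ ℕ ℂ} {f : ℕ → ℂ} {i : ℕ}

theorem eccentricity_fullGraph_johnson (hn : 2 * D ≤ n) (x : JohnsonVertex n D) :
    eccentricity (fullGraph (johnson n D) x) x = D := by
  simp only [eccentricity, fullGraph_dist, johnson_dist]
  refine le_antisymm (Finset.sup_le fun y _ => ?_) ?_
  · exact (Finset.card_le_card Finset.inter_subset_right).trans_eq y.2
  · obtain ⟨y, hyx, hyD⟩ := Finset.exists_subset_card_eq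
      (by rw [card_compl_johnsonVertex]; lia : D ≤ x.1ᶜ.card)
    calc D = (x.1ᶜ ∩ y).card := by rw [Finset.inter_eq_right.2 hyx, hyD]
      _ ≤ _ := Finset.le_sup (f := fun y : JohnsonVertex n D => (x.1ᶜ ∩ y.1).card)
        (Finset.mem_univ ⟨y, hyD⟩)

theorem IsUniformStructure.johnson_relation (hn : 2 * D ≤ n)
    (hU : IsUniformStructure (fullGraph (johnson n D) x) x U f) (hi : i + 3 ≤ D) {a b : ℕ}
    (ha : a ≤ 1) (hb : b ≤ 1) :
    U (i + 2) (i + 1) * ((n - D - i - b) * (D - i - a) * ((i + 1 - a) * (i + 1 - b)))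
      + (n - D - (i + 1) - b) * (D - (i + 1) - a) * ((i + 2 - a) * (i + 2 - b))
      + U (i + 2) (i + 3)
        * ((n - D - (i + 2) - b) * (D - (i + 2) - a) * ((i + 3 - a) * (i + 3 - b)))
      = f (i + 2) := by
  obtain ⟨φ, hφ, hφ0⟩ := exists_restrict_ne_zero x (a := a) (b := b)
    (by lia) (by lia) (by lia) (by lia)
  have hsupp : dualIdempotent (fullGraph (johnson n D) x) x (i + 1) *ᵥ restrict n D φ ≠ 0 := by
    rw [dualIdempotent_fullGraph, hφ.dualIdempotent_mulVec_restrict_ne_zero_iff hφ0, Set.mem_Icc]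
    lia
  have hrel := hφ.isLadder.fullGraph.uniform_relation hU
    (by rwa [eccentricity_fullGraph_johnson hn])
    (by
      rw [if_neg (by lia)]
      exact johnsonCoeff_self_succ_ne_zero (by lia) (by lia)) hsupp
  have hlt : ∀ j : ℕ, j ≠ j + 1 ∧ j + 1 ≠ j := by lia
  simp only [hlt, if_false, johnsonCoeff_self_succ, johnsonCoeff_succ_self] at hrel
  push_cast at hrel
  linear_combination hrel

-- The alternating sum of the four relations `a, b ∈ {0, 1}` eliminates `f`.
theorem IsUniformStructure.johnson_coeff_add (hn : 2 * D ≤ n)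
    (hU : IsUniformStructure (fullGraph (johnson n D) x) x U f) (hi : i + 3 ≤ D) :
    U (i + 2) (i + 1) + 1 + U (i + 2) (i + 3) = 0 := by
  have hD : (D : ℂ) ≠ 0 := Nat.cast_ne_zero.2 (by lia)
  have hnD : (n : ℂ) - D ≠ 0 := sub_ne_zero.2 (Nat.cast_injective.ne (by lia))
  have h00 := hU.johnson_relation hn hi (a := 0) (b := 0) zero_le_one zero_le_one
  have h10 := hU.johnson_relation hn hi (a := 1) (b := 0) le_rfl zero_le_one
  have h01 := hU.johnson_relation hn hi (a := 0) (b := 1) zero_le_one le_rfl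
  have h11 := hU.johnson_relation hn hi (a := 1) (b := 1) le_rfl le_rfl
  push_cast at h00 h10 h01 h11
  apply mul_left_cancel₀ (mul_ne_zero hD hnD)
  linear_combination h00 - h10 - h01 + h11

theorem IsUniformStructure.johnson_coeff_mul (hn : 2 * D ≤ n)
    (hU : IsUniformStructure (fullGraph (johnson n D) x) x U f) (hi : i + 3 ≤ D) :
    U (i + 2) (i + 3) * (D - 2 * i - 4) = U (i + 2) (i + 1) * (D - 2 * i - 2) := by
  have hnD : (n : ℂ) - D ≠ 0 := sub_ne_zero.2 (Nat.cast_injective.ne (by lia))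
  have h00 := hU.johnson_relation hn hi (a := 0) (b := 0) zero_le_one zero_le_one
  have h01 := hU.johnson_relation hn hi (a := 0) (b := 1) zero_le_one le_rfl
  push_cast at h00 h01
  apply mul_left_cancel₀ hnD
  linear_combination h00 - h01 - (n - D) * (i + 2) * (D - i - 1) * hU.johnson_coeff_add hn hi

theorem IsUniformStructure.johnson_coeff_mul_compl (hn : 2 * D ≤ n)
    (hU : IsUniformStructure (fullGraph (johnson n D) x) x U f) (hi : i + 3 ≤ D) :
    U (i + 2) (i + 3) * (n - D - 2 * i - 4) = U (i + 2) (i + 1) * (n - D - 2 * i - 2) := by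
  have hD : (D : ℂ) ≠ 0 := Nat.cast_ne_zero.2 (by lia)
  have h00 := hU.johnson_relation hn hi (a := 0) (b := 0) zero_le_one zero_le_one
  have h10 := hU.johnson_relation hn hi (a := 1) (b := 0) le_rfl zero_le_one
  push_cast at h00 h10
  apply mul_left_cancel₀ hD
  linear_combination h00 - h10 - D * (i + 2) * (n - D - i - 1) * hU.johnson_coeff_add hn hi

theorem not_supportsUniformStructure_johnson_of_lt (hD : 3 ≤ D) (hn : 2 * D < n)
    (x : JohnsonVertex n D) : ¬ SupportsUniformStructure (johnson n D) x := by
  rintro ⟨U, f, hU⟩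
  have hadd := hU.johnson_coeff_add hn.le (i := 0) hD
  have hmul := hU.johnson_coeff_mul hn.le (i := 0) hD
  have hmul' := hU.johnson_coeff_mul_compl hn.le (i := 0) hD
  have hne : (n : ℂ) - 2 * D ≠ 0 := sub_ne_zero.2 (by exact_mod_cast hn.ne')
  have heq : U 2 3 = U 2 1 := mul_left_cancel₀ hne (by linear_combination hmul' - hmul)
  push_cast at hmul
  exact one_ne_zero (by linear_combination hadd + hmul - (D - 3) * heq : (1 : ℂ) = 0)

-- The contradiction sits at the middle levels: for `D = 2m` the relations force
-- `U m (m - 1) = 0 = U (m + 1) (m + 2)`, for odd `D` those at level `(D + 1) / 2` are inconsistent.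
theorem not_supportsUniformStructure_johnson_two_mul (hD : 3 ≤ D) (x : JohnsonVertex (2 * D) D) :
    ¬ SupportsUniformStructure (johnson (2 * D) D) x := by
  rintro ⟨U, f, hU⟩
  obtain ⟨m, rfl | rfl⟩ := Nat.even_or_odd' D
  · obtain ⟨i, rfl⟩ := Nat.exists_eq_add_of_le' (show 2 ≤ m by lia)
    have hlow := hU.johnson_coeff_mul le_rfl (i := i) (by lia)
    have hup := hU.johnson_coeff_mul le_rfl (i := i + 1) (by lia)
    push_cast at hlow hup
    have hlow0 : U (i + 2) (i + 1) = 0 := by linear_combination -hlow / 2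
    have hup0 : U (i + 3) (i + 4) = 0 := by linear_combination -hup / 2
    have hoff := hU.1.off_diagonal
    rw [eccentricity_fullGraph_johnson le_rfl] at hoff
    rcases hoff with h | h
    · exact h (i + 2) (Finset.mem_Icc.2 ⟨by lia, by lia⟩) hlow0
    · exact h (i + 4) (Finset.mem_Icc.2 ⟨by lia, by lia⟩) hup0
  · obtain ⟨i, rfl⟩ := Nat.exists_eq_add_of_le' (show 1 ≤ m by lia)
    have hadd := hU.johnson_coeff_add le_rfl (i := i) (by lia)
    have hmul := hU.johnson_coeff_mul le_rfl (i := i) (by lia)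
    push_cast at hmul
    exact one_ne_zero (by linear_combination hadd + hmul : (1 : ℂ) = 0)

theorem not_supportsUniformStructure_johnson (hD : 3 ≤ D) (hn : 2 * D ≤ n)
    (x : JohnsonVertex n D) : ¬ SupportsUniformStructure (johnson n D) x := by
  obtain rfl | hlt := hn.eq_or_lt
  · exact not_supportsUniformStructure_johnson_two_mul hD x
  · exact not_supportsUniformStructure_johnson_of_lt hD hlt x

end JohnsonUniform

/-! ### Eigenvectors of the rook's graph -/

section Rook

variable {α β 𝕜 : Type*} [Field 𝕜] {m : α → β → 𝕜} {θ : 𝕜}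

theorem rook_eigenvector_cases [CharZero 𝕜] {s : Finset α} {t : Finset β} (hs : s.Nonempty)
    (ht : t.Nonempty) (hst : s.card ≠ t.card) (hm : ∑ j ∈ s, ∑ k ∈ t, m j k = 0)
    (hθ : ∀ j ∈ s, ∀ k ∈ t, ∑ i ∈ s, m i k + ∑ l ∈ t, m j l - 2 * m j k = θ * m j k) :
    (∃ g : α → 𝕜, ∑ j ∈ s, g j = 0 ∧ ∀ j ∈ s, ∀ k ∈ t, m j k = g j) ∨
    (∃ g : β → 𝕜, ∑ k ∈ t, g k = 0 ∧ ∀ j ∈ s, ∀ k ∈ t, m j k = g k) ∨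
    ((∀ k ∈ t, ∑ i ∈ s, m i k = 0) ∧ ∀ j ∈ s, ∑ l ∈ t, m j l = 0) := by
  have hs0 : (s.card : 𝕜) ≠ 0 := Nat.cast_ne_zero.2 hs.card_ne_zero
  have ht0 : (t.card : 𝕜) ≠ 0 := Nat.cast_ne_zero.2 ht.card_ne_zero
  have hm' : ∑ k ∈ t, ∑ j ∈ s, m j k = 0 := by rwa [Finset.sum_comm]
  have hcol : ∀ k ∈ t, (s.card - (θ + 2)) * ∑ i ∈ s, m i k = 0 := fun k hk => by
    have := Finset.sum_congr rfl fun j hj => hθ j hj k hk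
    rw [Finset.sum_sub_distrib, Finset.sum_add_distrib, Finset.sum_const, hm, ← Finset.mul_sum,
      ← Finset.mul_sum, nsmul_eq_mul] at this
    linear_combination this
  have hrow : ∀ j ∈ s, (t.card - (θ + 2)) * ∑ l ∈ t, m j l = 0 := fun j hj => by
    have := Finset.sum_congr rfl (hθ j hj)
    rw [Finset.sum_sub_distrib, Finset.sum_add_distrib, Finset.sum_const, hm', ← Finset.mul_sum,
      ← Finset.mul_sum, nsmul_eq_mul] at this
    linear_combination this
  by_cases h0 : θ + 2 = 0
  · refine .inr (.inr ⟨fun k hk => ?_, fun j hj => ?_⟩)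
    · exact (mul_eq_zero.1 (hcol k hk)).resolve_left (by rwa [h0, sub_zero])
    · exact (mul_eq_zero.1 (hrow j hj)).resolve_left (by rwa [h0, sub_zero])
  by_cases hsθ : (s.card : 𝕜) = θ + 2
  · have hrow0 : ∀ j ∈ s, ∑ l ∈ t, m j l = 0 := fun j hj =>
      (mul_eq_zero.1 (hrow j hj)).resolve_left
        (sub_ne_zero.2 fun htθ => hst (Nat.cast_injective (hsθ.trans htθ.symm)))
    refine .inr (.inl ⟨fun k => (∑ i ∈ s, m i k) / (θ + 2), ?_, fun j hj k hk => ?_⟩)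
    · rw [← Finset.sum_div, hm', zero_div]
    · rw [eq_div_iff h0]
      linear_combination hrow0 j hj - hθ j hj k hk
  · have hcol0 : ∀ k ∈ t, ∑ i ∈ s, m i k = 0 := fun k hk =>
      (mul_eq_zero.1 (hcol k hk)).resolve_left (sub_ne_zero.2 hsθ)
    refine .inl ⟨fun j => (∑ l ∈ t, m j l) / (θ + 2), ?_, fun j hj k hk => ?_⟩
    · rw [← Finset.sum_div, hm, zero_div]
    · rw [eq_div_iff h0]
      linear_combination hcol0 k hk - hθ j hj k hk

end Rook

section Swap

variable {α R : Type*} [DecidableEq α] [CommRing R] {s : Finset α} {j k : α}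

theorem inter_insert_erase_self (hk : k ∉ s) : s ∩ insert k (s.erase j) = s.erase j := by
  rw [Finset.inter_insert_of_notMem hk, Finset.inter_erase, Finset.inter_self]

variable [Fintype α]

theorem compl_inter_insert_erase_self (hk : k ∉ s) : sᶜ ∩ insert k (s.erase j) = {k} := by
  ext l
  grind [Finset.mem_compl]

theorem exists_isBiharmonic_one_zero {g : α → R} (hg : ∑ j ∈ s, g j = 0) :
    ∃ φ, IsBiharmonic s 1 0 φ ∧ ∀ j ∈ s, ∀ k ∈ sᶜ, φ (insert k (s.erase j)) = g j := by
  refine ⟨fun z => ∑ j ∈ s ∩ z, -g j, ⟨isHarmonic_one_sum (m := fun j _ => -g j)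
    (fun _ _ => rfl) (fun _ => by rw [Finset.sum_neg_distrib, hg, neg_zero]),
    IsInvariant.isHarmonic_zero fun z => ?_⟩, fun j hj k hk => ?_⟩
  · exact congrArg (fun t => ∑ j ∈ t, -g j) (isInvariant_inter disjoint_compl_right z)
  · rw [← Finset.sum_erase_add _ _ hj] at hg
    dsimp only
    rw [inter_insert_erase_self (Finset.mem_compl.1 hk), Finset.sum_neg_distrib]
    linear_combination -hg

theorem exists_isBiharmonic_zero_one {g : α → R} (hg : ∑ k ∈ sᶜ, g k = 0) :
    ∃ φ, IsBiharmonic s 0 1 φ ∧ ∀ j ∈ s, ∀ k ∈ sᶜ, φ (insert k (s.erase j)) = g k := by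
  refine ⟨fun z => ∑ k ∈ sᶜ ∩ z, g k, ⟨IsInvariant.isHarmonic_zero fun z => ?_,
    isHarmonic_one_sum (m := fun k _ => g k) (fun _ _ => rfl) (fun _ => hg)⟩, fun j _ k hk => ?_⟩
  · exact congrArg (fun t => ∑ k ∈ t, g k) (isInvariant_inter disjoint_compl_left z)
  · dsimp only
    rw [compl_inter_insert_erase_self (Finset.mem_compl.1 hk), Finset.sum_singleton]

theorem exists_isBiharmonic_one_one {m : α → α → R} (hcol : ∀ k ∈ sᶜ, ∑ j ∈ s, m j k = 0)
    (hrow : ∀ j ∈ s, ∑ k ∈ sᶜ, m j k = 0) :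
    ∃ φ, IsBiharmonic s 1 1 φ ∧ ∀ j ∈ s, ∀ k ∈ sᶜ, φ (insert k (s.erase j)) = m j k := by
  refine ⟨fun z => ∑ j ∈ s ∩ z, ∑ k ∈ sᶜ ∩ z, -m j k, ⟨?_, ?_⟩, fun j hj k hk => ?_⟩
  · refine isHarmonic_one_sum (m := fun j z => ∑ k ∈ sᶜ ∩ z, -m j k) (fun j z => ?_) fun z => ?_
    · exact congrArg (fun t => ∑ k ∈ t, -m j k) (isInvariant_inter disjoint_compl_left z)
    · rw [Finset.sum_comm]
      refine Finset.sum_eq_zero fun k hk => ?_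
      rw [Finset.sum_neg_distrib, hcol k (Finset.mem_inter.1 hk).1, neg_zero]
  · simp only [Finset.sum_comm (s := s ∩ _)]
    refine isHarmonic_one_sum (m := fun k z => ∑ j ∈ s ∩ z, -m j k) (fun k z => ?_) fun z => ?_
    · exact congrArg (fun t => ∑ j ∈ t, -m j k) (isInvariant_inter disjoint_compl_right z)
    · rw [Finset.sum_comm]
      refine Finset.sum_eq_zero fun j hj => ?_
      rw [Finset.sum_neg_distrib, hrow j (Finset.mem_inter.1 hj).1, neg_zero]
  · have hcolk := hcol k hk
    rw [← Finset.sum_erase_add _ _ hj] at hcolk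
    dsimp only
    rw [inter_insert_erase_self (Finset.mem_compl.1 hk),
      compl_inter_insert_erase_self (Finset.mem_compl.1 hk)]
    simp only [Finset.sum_singleton, Finset.sum_neg_distrib]
    linear_combination -hcolk

theorem exists_isBiharmonic_of_rook_eigenvector {𝕜 : Type*} [Field 𝕜] [CharZero 𝕜] {θ : 𝕜}
    {m : α → α → 𝕜} (hs : s.Nonempty) (hs' : sᶜ.Nonempty) (hcard : s.card ≠ sᶜ.card)
    (hm : ∑ j ∈ s, ∑ k ∈ sᶜ, m j k = 0)
    (hθ : ∀ j ∈ s, ∀ k ∈ sᶜ, ∑ i ∈ s, m i k + ∑ l ∈ sᶜ, m j l - 2 * m j k = θ * m j k) :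
    ∃ a b φ, max a b = 1 ∧ IsBiharmonic s a b φ ∧
      ∀ j ∈ s, ∀ k ∈ sᶜ, φ (insert k (s.erase j)) = m j k := by
  obtain ⟨g, hg, hmg⟩ | ⟨g, hg, hmg⟩ | ⟨hcol, hrow⟩ := rook_eigenvector_cases hs hs' hcard hm hθ
  · obtain ⟨φ, hφ, hφg⟩ := exists_isBiharmonic_one_zero hg
    exact ⟨1, 0, φ, rfl, hφ, fun j hj k hk => (hφg j hj k hk).trans (hmg j hj k hk).symm⟩
  · obtain ⟨φ, hφ, hφg⟩ := exists_isBiharmonic_zero_one hg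
    exact ⟨0, 1, φ, rfl, hφ, fun j hj k hk => (hφg j hj k hk).trans (hmg j hj k hk).symm⟩
  · obtain ⟨φ, hφ, hφm⟩ := exists_isBiharmonic_one_one hcol hrow
    exact ⟨1, 1, φ, rfl, hφ, hφm⟩

-- The neighbours of `s` in a Johnson graph induce a rook's graph.
theorem exchange_insert_erase_self {f : Finset α → R} (hf : ∀ z, (sᶜ ∩ z).card ≠ 1 → f z = 0)
    (hj : j ∈ s) (hk : k ∈ sᶜ) :
    exchange f (insert k (s.erase j)) = ∑ i ∈ s, f (insert k (s.erase i))
      + ∑ l ∈ sᶜ, f (insert l (s.erase j)) - 2 * f (insert k (s.erase j)) := by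
  have hks := Finset.mem_compl.1 hk
  have hcompl : (insert k (s.erase j))ᶜ = insert j (sᶜ.erase k) := by
    ext l
    grind [Finset.mem_compl]
  have hjk : j ∉ sᶜ.erase k := by grind [Finset.mem_compl]
  have hke : k ∉ s.erase j := by grind
  have hrow : ∑ l ∈ (insert k (s.erase j))ᶜ, f (insert l ((insert k (s.erase j)).erase k))
      = ∑ l ∈ sᶜ, f (insert l (s.erase j)) - f (insert k (s.erase j)) := by
    rw [hcompl, Finset.erase_insert hke, Finset.sum_insert hjk, Finset.insert_erase hj,
      hf s (by rw [Finset.inter_comm, Finset.inter_compl, Finset.card_empty]; exact zero_ne_one),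
      zero_add, ← Finset.sum_erase_add _ _ hk, add_sub_cancel_right]
  have hcol : ∀ i ∈ s.erase j, ∑ l ∈ (insert k (s.erase j))ᶜ,
      f (insert l ((insert k (s.erase j)).erase i)) = f (insert k (s.erase i)) := fun i hi => by
    have hvanish : ∀ l ∈ sᶜ.erase k, f (insert l ((insert k (s.erase j)).erase i)) = 0 :=
      fun l hl => hf _ (by
        rw [show sᶜ ∩ insert l ((insert k (s.erase j)).erase i) = {k, l} by
            ext
            grind [Finset.mem_compl],
          Finset.card_pair (Finset.ne_of_mem_erase hl).symm]
        exact Nat.succ_ne_self 1)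
    rw [hcompl, Finset.sum_insert hjk, Finset.sum_eq_zero hvanish, add_zero]
    congr 1
    grind
  rw [exchange, Finset.sum_insert hke, hrow, Finset.sum_congr rfl hcol,
    ← Finset.sum_erase_add s _ hj]
  ring

end Swap

/-! ### Modules of endpoint one -/

theorem IsTModule.exists_mulVec_eq_smul {X : Type*} [Fintype X] [DecidableEq X]
    {G : SimpleGraph X} {x : X} {W : Submodule ℂ (X → ℂ)} (hW : IsTModule G x W) {i : ℕ}
    (hi : i ∈ dualSupport G x W) :
    ∃ w ∈ W, w ≠ 0 ∧ dualIdempotent G x i *ᵥ w = w ∧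
      ∃ θ : ℂ, dualIdempotent G x i *ᵥ (adjacency G *ᵥ w) = θ • w := by
  let E := (dualIdempotent G x i).mulVecLin
  let A := (adjacency G).mulVecLin
  let V := W.map E
  have hE : ∀ v, E (E v) = E v := fun v => by
    change _ *ᵥ (_ *ᵥ v) = _
    rw [mulVec_mulVec, dualIdempotent_mul_dualIdempotent, if_pos rfl]
    rfl
  have hVW : V ≤ W := by
    rintro _ ⟨w, hw, rfl⟩
    exact hW.dualIdempotent_mulVec_mem i hw
  have hEA : ∀ v ∈ V, (E ∘ₗ A) v ∈ V := fun v hv =>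
    ⟨A v, hW.adjacency_mulVec_mem (hVW hv), rfl⟩
  obtain ⟨u, hu, hu0⟩ := hi
  have : Nontrivial V := ⟨⟨E u, u, hu, rfl⟩, 0, fun h => hu0 (congrArg Subtype.val h)⟩
  obtain ⟨θ, hθ⟩ := Module.End.exists_eigenvalue ((E ∘ₗ A).restrict hEA)
  obtain ⟨⟨v, hv⟩, hvθ⟩ := hθ.exists_hasEigenvector
  have hv0 : v ≠ 0 := fun h => hvθ.2 (Subtype.ext h)
  refine ⟨v, hVW hv, hv0, ?_, θ, congrArg Subtype.val hvθ.apply_eq_smul⟩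
  obtain ⟨w, -, rfl⟩ := hv
  exact hE w

section Johnson

variable {n D : ℕ} {x : JohnsonVertex n D}

theorem exists_isBiharmonic_of_mulVec_eq_smul (hn : 2 * D < n) {w : JohnsonVertex n D → ℂ}
    {θ : ℂ} (hw0 : w ≠ 0) (hw : dualIdempotent (johnson n D) x 1 *ᵥ w = w)
    (hx : dualIdempotent (johnson n D) x 0 *ᵥ (adjacency (johnson n D) *ᵥ w) = 0)
    (hθ : dualIdempotent (johnson n D) x 1 *ᵥ (adjacency (johnson n D) *ᵥ w) = θ • w) :
    ∃ a b φ, max a b = 1 ∧ IsBiharmonic x.1 a b φ ∧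
      dualIdempotent (johnson n D) x 1 *ᵥ restrict n D φ = w := by
  obtain ⟨f, hfD, rfl⟩ := exists_restrict_eq w
  have hf : ∀ z, (x.1ᶜ ∩ z).card ≠ 1 → f z = 0 := fun z hz => by
    by_contra hfz
    have hwz := congrFun hw ⟨z, hfD z hfz⟩
    rw [dualIdempotent_mulVec_apply, johnson_dist, if_neg hz] at hwz
    exact hfz hwz.symm
  obtain ⟨y, hy : f y.1 ≠ 0⟩ := Function.ne_iff.1 hw0
  have hxy : (johnson n D).dist x y = 1 := by
    rw [johnson_dist]
    exact not_not.1 (mt (hf y.1) hy)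
  obtain ⟨j, k, hj, hk, -⟩ := johnson_dist_eq_one_iff.1 hxy
  have hcard : x.1.card ≠ x.1ᶜ.card := by
    rw [x.2, card_compl_johnsonVertex]
    lia
  rw [adjacency_mulVec_restrict] at hx hθ
  obtain ⟨a, b, φ, hab, hφ, hφf⟩ := exists_isBiharmonic_of_rook_eigenvector ⟨j, hj⟩
    ⟨k, Finset.mem_compl.2 hk⟩ hcard (m := fun j k => f (insert k (x.1.erase j))) (θ := θ)
    (by
      have hxx := congrFun hx x
      rwa [dualIdempotent_mulVec_apply, SimpleGraph.dist_self, if_pos rfl] at hxx)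
    (fun j hj k hk => by
      have hjk := congrFun hθ (swap x hj (Finset.mem_compl.1 hk))
      rw [dualIdempotent_mulVec_apply,
        if_pos (johnson_dist_eq_one_iff.2 ⟨j, k, hj, _, rfl⟩)] at hjk
      exact (exchange_insert_erase_self hf hj hk).symm.trans hjk)
  refine ⟨a, b, φ, hab, hφ, ?_⟩
  rw [← hw]
  ext y
  rw [dualIdempotent_mulVec_apply, dualIdempotent_mulVec_apply]
  split_ifs with hy
  · obtain ⟨j, k, hj, hk, rfl⟩ := johnson_dist_eq_one_iff.1 hy
    exact hφf j hj k (Finset.mem_compl.2 hk)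
  · rfl

theorem exists_eq_harmonicModule_of_endpoint_eq_one (hn : 2 * D < n)
    {W : Submodule ℂ (JohnsonVertex n D → ℂ)} (hW : IsIrreducibleTModule (johnson n D) x W)
    (hend : endpoint (johnson n D) x W = 1) :
    ∃ a b φ, max a b = 1 ∧ IsBiharmonic x.1 a b φ ∧ restrict n D φ ≠ 0 ∧
      W = harmonicModule x φ := by
  obtain ⟨hWT, -, hirr⟩ := hW
  have h1 : 1 ∈ dualSupport (johnson n D) x W :=
    hend ▸ Nat.sInf_mem (Nat.nonempty_of_sInf_eq_succ hend)
  have h0 : 0 ∉ dualSupport (johnson n D) x W := fun h => by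
    have : endpoint (johnson n D) x W ≤ 0 := Nat.sInf_le h
    lia
  obtain ⟨w, hwW, hw0, hw, θ, hθ⟩ := hWT.exists_mulVec_eq_smul h1
  obtain ⟨a, b, φ, hab, hφ, hφw⟩ := exists_isBiharmonic_of_mulVec_eq_smul hn hw0 hw
    (not_not.1 fun h => h0 ⟨_, hWT.adjacency_mulVec_mem hwW, h⟩) hθ
  have hφ1 : dualIdempotent (johnson n D) x 1 *ᵥ restrict n D φ ≠ 0 := hφw ▸ hw0
  have hφ0 : restrict n D φ ≠ 0 := fun h => hφ1 (by rw [h, mulVec_zero])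
  have hle : harmonicModule x φ ≤ W := hφ.harmonicModule_le hWT hφ1 (hφw ▸ hwW)
  obtain ⟨hT, hne, -⟩ := hφ.isIrreducibleTModule_harmonicModule hφ0
  exact ⟨a, b, φ, hab, hφ, hφ0, ((hirr _ hT hle).resolve_left hne).symm⟩

theorem exists_eq_harmonicModule_of_isIrreducibleOfType (hD : 3 ≤ D) (hn : 2 * D < n) {t : ℕ}
    {W : Submodule ℂ (JohnsonVertex n D → ℂ)}
    (hW : IsIrreducibleOfType (johnson n D) x 1 (D - 2) t W) :
    ∃ b φ, b ≤ 1 ∧ t = 1 + b ∧ IsBiharmonic x.1 1 b φ ∧ restrict n D φ ≠ 0 ∧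
      W = harmonicModule x φ := by
  obtain ⟨hirr, hend, hdiam, hdual⟩ := hW
  obtain ⟨a, b, φ, hab, hφ, hφ0, rfl⟩ := exists_eq_harmonicModule_of_endpoint_eq_one hn hirr hend
  rw [hφ.moduleDiameter_harmonicModule hφ0] at hdiam
  obtain rfl : a = 1 := by lia
  rw [hφ.dualEndpoint_harmonicModule hφ0 hn.le (by lia)] at hdual
  exact ⟨b, φ, by lia, hdual.symm, hφ, hφ0, rfl⟩

namespace IsBiharmonic

variable {b : ℕ} {φ ψ : Finset (Fin n) → ℂ}

theorem isIrreducibleOfType_harmonicModule (h : IsBiharmonic x.1 1 b φ)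
    (hφ : restrict n D φ ≠ 0) (hD : 2 ≤ D) (hn : 2 * D < n) (hb : b ≤ 1) :
    IsIrreducibleOfType (johnson n D) x 1 (D - 2) (1 + b) (harmonicModule x φ) := by
  refine ⟨h.isIrreducibleTModule_harmonicModule hφ, ?_, ?_,
    h.dualEndpoint_harmonicModule hφ hn.le (by lia)⟩
  · rw [h.endpoint_harmonicModule hφ]
    lia
  · rw [h.moduleDiameter_harmonicModule hφ]
    lia

theorem isTModule_fullGraph_harmonicModule {a : ℕ} (h : IsBiharmonic x.1 a b φ) :
    IsTModule (fullGraph (johnson n D) x) x (harmonicModule x φ) := by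
  rw [harmonicModule, ← radialSpan_fullGraph]
  exact h.isLadder.fullGraph.isTModule

-- The product of the coefficients between the levels 1 and 2 is an invariant of the module.
theorem not_isTIsomorphic_fullGraph_harmonicModule (h : IsBiharmonic x.1 1 0 φ)
    (h' : IsBiharmonic x.1 1 1 ψ) (hψ : restrict n D ψ ≠ 0) (hD : 3 ≤ D) (hn : 2 * D < n) :
    ¬ IsTIsomorphic (fullGraph (johnson n D) x) x (harmonicModule x φ) (harmonicModule x ψ) := by
  rw [harmonicModule, harmonicModule, ← radialSpan_fullGraph _ _ (restrict n D φ),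
    ← radialSpan_fullGraph _ _ (restrict n D ψ)]
  intro hσ
  have hψ1 : dualIdempotent (johnson n D) x 1 *ᵥ restrict n D ψ ≠ 0 :=
    (h'.dualIdempotent_mulVec_restrict_ne_zero_iff hψ).2 ⟨by lia, by lia⟩
  rw [← dualIdempotent_fullGraph] at hψ1
  have hcoeff := h.isLadder.fullGraph.coeff_mul_eq_of_isTIsomorphic h'.isLadder.fullGraph hσ 2 hψ1
  rw [if_neg (by decide), if_neg (by decide), if_neg (by decide), if_neg (by decide),
    johnsonCoeff_succ_self n D 1 0 1, johnsonCoeff_succ_self n D 1 1 1,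
    johnsonCoeff_self_succ n D 1 0 1, johnsonCoeff_self_succ n D 1 1 1] at hcoeff
  push_cast at hcoeff
  have hzero : ((D : ℂ) - 2) * (n - D) = 0 := by linear_combination -hcoeff
  refine mul_ne_zero (sub_ne_zero.2 ?_) (sub_ne_zero.2 ?_) hzero
  · exact_mod_cast (by lia : D ≠ 2)
  · exact_mod_cast (by lia : n ≠ D)

end IsBiharmonic

end Johnson

end

end UniformStructure

theorem theorem9p4 (n D : ℕ) (hD : 3 ≤ D) (hn : 2 * D ≤ n)
    (x : UniformStructure.JohnsonVertex n D) :
    -- `J(n, D)` does not support a uniform structure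
    ¬ UniformStructure.SupportsUniformStructure (UniformStructure.johnson n D) x ∧
    (2 * D < n →
      -- the irreducible `T`-modules of endpoint `1` and diameter `D - 2` have dual endpoint
      -- `1` or `2`, both occur, and each dual endpoint occurs exactly once up to isomorphism
      (∃ W, UniformStructure.IsIrreducibleOfType (UniformStructure.johnson n D) x 1 (D - 2) 1 W) ∧
      (∃ W, UniformStructure.IsIrreducibleOfType (UniformStructure.johnson n D) x 1 (D - 2) 2 W) ∧
      (∀ t W, UniformStructure.IsIrreducibleOfType (UniformStructure.johnson n D) x 1 (D - 2) t W →
        t = 1 ∨ t = 2) ∧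
      (∀ t W W',
        UniformStructure.IsIrreducibleOfType (UniformStructure.johnson n D) x 1 (D - 2) t W →
        UniformStructure.IsIrreducibleOfType (UniformStructure.johnson n D) x 1 (D - 2) t W' →
        UniformStructure.IsTIsomorphic (UniformStructure.johnson n D) x W W') ∧
      -- the two modules are `T_f`-modules, and are not isomorphic as such
      (∀ W W',
        UniformStructure.IsIrreducibleOfType (UniformStructure.johnson n D) x 1 (D - 2) 1 W →
        UniformStructure.IsIrreducibleOfType (UniformStructure.johnson n D) x 1 (D - 2) 2 W' →
        UniformStructure.IsTModule
          (UniformStructure.fullGraph (UniformStructure.johnson n D) x) x W ∧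
        UniformStructure.IsTModule
          (UniformStructure.fullGraph (UniformStructure.johnson n D) x) x W' ∧
        ¬ UniformStructure.IsTIsomorphic
          (UniformStructure.fullGraph (UniformStructure.johnson n D) x) x W W')) := by
  open UniformStructure in
  refine ⟨not_supportsUniformStructure_johnson hD hn x, fun hn' => ?_⟩
  have exists_module (b : ℕ) (hb : b ≤ 1) :
      ∃ W, IsIrreducibleOfType (johnson n D) x 1 (D - 2) (1 + b) W := by
    obtain ⟨φ, hφ, hφ0⟩ := exists_restrict_ne_zero x (a := 1) (b := b)
      (by lia) (by lia) (by lia) (by lia)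
    exact ⟨_, hφ.isIrreducibleOfType_harmonicModule hφ0 (by lia) hn' hb⟩
  refine ⟨exists_module 0 zero_le_one, exists_module 1 le_rfl, fun t W hW => ?_,
    fun t W W' hW hW' => ?_, fun W W' hW hW' => ?_⟩
  · obtain ⟨b, -, hb, rfl, -⟩ := exists_eq_harmonicModule_of_isIrreducibleOfType hD hn' hW
    lia
  · obtain ⟨b, φ, -, rfl, hφ, hφ0, rfl⟩ :=
      exists_eq_harmonicModule_of_isIrreducibleOfType hD hn' hW
    obtain ⟨b', φ', -, hb, hφ', hφ0', rfl⟩ :=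
      exists_eq_harmonicModule_of_isIrreducibleOfType hD hn' hW'
    obtain rfl := Nat.add_left_cancel hb
    exact hφ.isTIsomorphic_harmonicModule hφ' hφ0 hφ0'
  · obtain ⟨b, φ, -, hb, hφ, -, rfl⟩ := exists_eq_harmonicModule_of_isIrreducibleOfType hD hn' hW
    obtain ⟨b', ψ, -, hb', hψ, hψ0, rfl⟩ :=
      exists_eq_harmonicModule_of_isIrreducibleOfType hD hn' hW'
    obtain rfl : b = 0 := by lia
    obtain rfl : b' = 1 := by lia
    exact ⟨hφ.isTModule_fullGraph_harmonicModule, hψ.isTModule_fullGraph_harmonicModule,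
      hφ.not_isTIsomorphic_fullGraph_harmonicModule hψ hψ0 hD hn'⟩
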